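/- **Model.** A tile is a unit square centered at a point of $\mathbb{Z}^2$ with at most one glue type on each edge; each glue type $g$ has a non-negative integer strength $\mathrm{str}(g)$, and tiles are not rotated. An assembly is a finite set of tiles at pairwise different coordinates; its shape is the set of these coordinates. Its bond graph has the tiles as vertices, and the weight of the edge between two adjacent tiles is the strength of the glue on their common edge if both carry the same glue type there, and $0$ otherwise. A nonempty assembly is $\tau$-stable if every cut of its bond graph into two nonempty parts has weight at least $\tau$. A 6-HAM system at temperature $\tau$ has a finite set $T$ of tile types. Its producible assemblies are defined recursively: every single translated tile from $T$ is producible, and whenever translates of at most six producible assemblies (repetitions allowed) have pairwise disjoint shapes and their union is $\tau$-stable, this union is producible. The system self-assembles an infinite shape $X\subset\mathbb{Z}^2$ if every producible assembly $A$ can grow, through a sequence of such steps in which the current assembly is one of the combined assemblies, so that the union of the assemblies of the sequence has as its shape exactly a translate of $X$. **Fractal.** Let $S_0=\{(0,0),(-1,0),(0,1),(-1,1)\}$, $S_{i+1}=S_i\cup(S_i+2^i(1,2))\cup(S_i+2^i(-1,2))$, and $S_\infty=\bigcup_{i\ge0}S_i$ (the non-tree discrete Sierpinski triangle). **Theorem.**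 There is a 6-HAM system at temperature $2$ with exactly $30$ tile types that near-perfectly assembles $S_\infty$ at scale factor $1$, that is: 0. the system self-assembles $S_\infty$; 1. for every $i\ge 0$ there is a producible assembly whose shape is a subset of $S_i$ missing at most $6$ points of $S_i$, all of them among the leftmost, rightmost and bottommost points of $S_i$; 2. there is a constant $c$ such that for every producible assembly $A$ the shape of some translate of $A$ is a subset of some $S_i$ with $|S_i\setminus \mathrm{shape}|\le c$. -/

import Mathlib

/-- A tile type: a unit square with at most one glue type on each edge. Glue types are named by
natural numbers; `none` is an edge without glue. Tiles are not rotated. -/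
@[ext] structure TileType where
  north : Option ℕ
  east : Option ℕ
  south : Option ℕ
  west : Option ℕ
deriving DecidableEq

/-- A tile placed in the plane: the coordinates of its center and its type. -/
abbrev PlacedTile := (ℤ × ℤ) × TileType

/-- A finite set of placed tiles. It is an assembly if the coordinates are unique, see
`IsAssembly`. -/
abbrev Assembly := Finset PlacedTile

/-- The tiles of `A` are at pairwise different coordinates. -/
def IsAssembly (A : Assembly) : Prop :=
  ∀ x ∈ A, ∀ y ∈ A, x.1 = y.1 → x = y

/-- The shape of an assembly: the set of the coordinates of its tiles. -/
def shape (A : Assembly) : Set (ℤ × ℤ) :=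
  {p | ∃ x ∈ A, x.1 = p}

/-- The translate of an assembly by the vector `v`. -/
def translateBy (v : ℤ × ℤ) (A : Assembly) : Assembly :=
  A.image (fun x => (x.1 + v, x.2))

/-- The strength with which two overlapping glue points bind: the strength of the glue if the two
glues are of the same type, and zero otherwise. -/
def glueStrength (str : ℕ → ℕ) : Option ℕ → Option ℕ → ℕ
  | some g, some g' => if g = g' then str g else 0
  | _, _ => 0

/-- The weight of the edge between two placed tiles in the bond graph. -/
def bond (str : ℕ → ℕ) (x y : PlacedTile) : ℕ :=
  if y.1 = x.1 + (1, 0) then glueStrength str x.2.east y.2.west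
  else if x.1 = y.1 + (1, 0) then glueStrength str x.2.west y.2.east
  else if y.1 = x.1 + (0, 1) then glueStrength str x.2.north y.2.south
  else if x.1 = y.1 + (0, 1) then glueStrength str x.2.south y.2.north
  else 0

/-- `A` is a (nonempty) `τ`-stable assembly: every cut of its bond graph into two nonempty parts
has weight at least `τ`. -/
def Stable (str : ℕ → ℕ) (τ : ℕ) (A : Assembly) : Prop :=
  IsAssembly A ∧ A.Nonempty ∧
    ∀ X ⊆ A, X.Nonempty → X ≠ A → τ ≤ ∑ x ∈ X, ∑ y ∈ A \ X, bond str x y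

/-- The positioned assemblies `F i`, which occupy pairwise disjoint sets of coordinates, together
form the `τ`-stable assembly `C`. -/
def FormsStable (str : ℕ → ℕ) (τ : ℕ) {r : ℕ} (F : Fin r → Assembly) (C : Assembly) : Prop :=
  (∀ i j, i ≠ j → Disjoint (shape (F i)) (shape (F j))) ∧
    C = Finset.univ.biUnion F ∧ Stable str τ C

/-- The assemblies `F i` are `τ`-combinable into `C`: suitable translates of them form the
`τ`-stable assembly `C`. -/
def CombinableInto (str : ℕ → ℕ) (τ : ℕ) {r : ℕ} (F : Fin r → Assembly) (C : Assembly) : Prop :=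
  ∃ v : Fin r → ℤ × ℤ, FormsStable str τ (fun i => translateBy (v i) (F i)) C

/-- A multiple handed tile assembly system: a finite tile set, the strengths of the glue types,
the temperature and the number of hands. -/
structure HAMSystem where
  tiles : Finset TileType
  str : ℕ → ℕ
  temperature : ℕ
  temperature_pos : 0 < temperature
  hands : ℕ
  hands_pos : 0 < hands

/-- The producible assemblies of a multiple handed system. -/
inductive Producible (Γ : HAMSystem) : Assembly → Prop
  | base (t : TileType) (ht : t ∈ Γ.tiles) (p : ℤ × ℤ) : Producible Γ {(p, t)}
  | combine (r : ℕ) (hr : r ≤ Γ.hands) (F : Fin r → Assembly) (C : Assembly)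
      (hF : ∀ i, Producible Γ (F i)) (hC : CombinableInto Γ.str Γ.temperature F C) :
      Producible Γ C

/-- `A` grows into `B` in one step: `B` is formed by `A`, in its place, and at most `h - 1` further
producible assemblies, where `h` is the number of hands. -/
def GrowsInOneStep (Γ : HAMSystem) (A B : Assembly) : Prop :=
  ∃ r ≤ Γ.hands, ∃ F : Fin r → Assembly,
    (∀ i, Producible Γ (F i)) ∧ (∃ i, F i = A) ∧ FormsStable Γ.str Γ.temperature F B

/-- The system (finitely) self-assembles the infinite shape `X`: every producible assembly can grow,
in a sequence of steps, so that the limit of the sequence places tiles exactly on the points of a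
translate of `X`. -/
def SelfAssembles (Γ : HAMSystem) (X : Set (ℤ × ℤ)) : Prop :=
  ∀ A, Producible Γ A → ∃ f : ℕ → Assembly, f 0 = A ∧
    (∀ k, GrowsInOneStep Γ (f k) (f (k + 1))) ∧
    ∃ v : ℤ × ℤ, (⋃ k, shape (f k)) = (fun p => p + v) '' X

/-- The system near perfectly assembles the pattern `⋃ i, P i` with the stages `P i`. -/
def NearPerfectlyAssembles (Γ : HAMSystem) (P : ℕ → Set (ℤ × ℤ)) : Prop :=
  SelfAssembles Γ (⋃ i, P i) ∧
    (∃ c : ℕ, ∀ i, ∃ A, Producible Γ A ∧ shape A ⊆ P i ∧ (P i \ shape A).encard ≤ c) ∧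
    (∃ c : ℕ, ∀ A, Producible Γ A → ∃ (v : ℤ × ℤ) (i : ℕ),
      shape (translateBy v A) ⊆ P i ∧ (P i \ shape (translateBy v A)).encard ≤ c)

/-- The stages of the (non-tree) discrete Sierpinski triangle. -/
def sierpinskiStage : ℕ → Set (ℤ × ℤ)
  | 0 => {(0, 0), (-1, 0), (0, 1), (-1, 1)}
  | i + 1 => sierpinskiStage i ∪
      ((fun p => p + (2 : ℤ) ^ i • ((1, 2) : ℤ × ℤ)) '' sierpinskiStage i ∪
       (fun p => p + (2 : ℤ) ^ i • ((-1, 2) : ℤ × ℤ)) '' sierpinskiStage i)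

/-- The leftmost, the rightmost and the bottommost points of a shape. -/
def cornerPoints (X : Set (ℤ × ℤ)) : Set (ℤ × ℤ) :=
  {p | p ∈ X ∧ ((∀ q ∈ X, p.1 ≤ q.1) ∨ (∀ q ∈ X, q.1 ≤ p.1) ∨ (∀ q ∈ X, p.2 ≤ q.2))}

/-! The fractal is assembled along its own recursion. A stage of level `n + 1` consists of three
stages of level `n` (`Y` below, `X` and `Z` above) and three links. A stage covers all but its two
leftmost and two rightmost points and, if it stands on a core, its two bottommost points. The left
and right links fill the points missing where `X` and `Z` stand on `Y`, and the top link fills the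
gap between `X` and `Z`. Level 1 is a core, or an apex, which has the bottom points but no glue
there. A stage on an apex can only serve as `Y`, so it is the tip of the infinite triangle.

All glues between motifs have strength 1, so at temperature 2 a single contact holds nothing. The
six pieces of a stage form a cycle, every cut of a cycle is crossed at least twice, and six hands
close the cycle in one step. This gives stages of every level, and each of them can grow on.

The main point is the converse, `Producible.isStage_or_subset`: nothing is producible except stages
and stable parts of single motifs. Let at most six such pieces combine, and group the parts of the
same motif. Unless one group is everything, each group is held by two weak contacts. So each link is
held at both ends, and each body (a stage, or a part of a core or apex) is held at two of its three
corners. `exists_triangle` looks at the leftmost and the rightmost of the bodies that reach highest.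
These, what supports them and the link beside them already account for six groups, and the
coordinates force three bodies of the same size in the position of a stage. Finally the pieces must
be complete, because a motif is glued so that a stable part with the two contacts needed is the
whole motif: the core is a weak cycle, the apex consists of two strong halves with two weak seams,
and a link is a strong path with its outer glues at the ends.

Everything producible is thus a stage, or extends to one, and misses boundedly many points of some
`sierpinskiStage`. -/

/-! ### The tile set -/

/-- The tile types by their place in a motif: the hexagonal core `c`, the apex `a`, the left link
`l`, the right link `r` and the two interchangeable top links `s` and `t`. -/
inductive Role
  | c0 | c1 | c2 | c3 | c4 | c5
  | a0 | a1 | a2 | a3 | a4 | a5 | a6 | a7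
  | l0 | l1 | l2 | l3
  | r0 | r1 | r2 | r3
  | s0 | s1 | s2 | s3
  | t0 | t1 | t2 | t3
deriving DecidableEq

instance : Fintype Role where
  elems := {.c0, .c1, .c2, .c3, .c4, .c5, .a0, .a1, .a2, .a3, .a4, .a5, .a6, .a7, .l0, .l1, .l2, .l3,
    .r0, .r1, .r2, .r3, .s0, .s1, .s2, .s3, .t0, .t1, .t2, .t3}
  complete := by rintro ⟨⟩ <;> decide

inductive Motif
  | core | apex | left | right | top | top'
deriving DecidableEq

namespace Role

/-- The motif to which a tile belongs. -/
def motif : Role → Motif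
  | c0 | c1 | c2 | c3 | c4 | c5 => .core
  | a0 | a1 | a2 | a3 | a4 | a5 | a6 | a7 => .apex
  | l0 | l1 | l2 | l3 => .left
  | r0 | r1 | r2 | r3 => .right
  | s0 | s1 | s2 | s3 => .top
  | t0 | t1 | t2 | t3 => .top'

/-- The position of a tile relative to the origin of its motif. -/
def off : Role → ℤ × ℤ
  | c0 => (-1, 2) | c1 => (-1, 3) | c2 => (0, 3) | c3 => (0, 2) | c4 => (0, 1) | c5 => (-1, 1)
  | a0 => (-1, 2) | a1 => (-1, 3) | a2 => (-1, 1) | a3 => (-1, 0)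
  | a4 => (0, 2) | a5 => (0, 3) | a6 => (0, 1) | a7 => (0, 0)
  | l0 => (0, 0) | l1 => (0, 1) | l2 => (0, 2) | l3 => (-1, 2)
  | r0 => (0, 0) | r1 => (0, 1) | r2 => (0, 2) | r3 => (1, 2)
  | s0 | t0 => (0, 0) | s1 | t1 => (0, 1) | s2 | t2 => (1, 1) | s3 | t3 => (1, 0)

/-- The glues, in the order north, east, south, west. The glues `0, 1, 2, 29` join different
motifs, the others join the tiles of one motif. -/
def type : Role → TileType
  | c0 => ⟨some 3, none, some 8, some 0⟩
  | c1 => ⟨none, some 4, some 3, none⟩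
  | c2 => ⟨none, none, some 5, some 4⟩
  | c3 => ⟨some 5, some 1, some 6, none⟩
  | c4 => ⟨some 6, none, some 29, some 7⟩
  | c5 => ⟨some 8, some 7, some 2, none⟩
  | a0 => ⟨some 11, none, some 12, some 0⟩
  | a1 => ⟨none, some 9, some 11, none⟩
  | a2 => ⟨some 12, none, some 13, none⟩
  | a3 => ⟨some 13, some 10, none, none⟩
  | a4 => ⟨some 14, some 1, some 15, none⟩
  | a5 => ⟨none, none, some 14, some 9⟩
  | a6 => ⟨some 15, none, some 16, none⟩
  | a7 => ⟨some 16, none, none, some 10⟩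
  | l0 => ⟨some 17, some 0, none, none⟩
  | l1 => ⟨some 18, none, some 17, none⟩
  | l2 => ⟨none, none, some 18, some 19⟩
  | l3 => ⟨some 2, some 19, none, none⟩
  | r0 => ⟨some 20, none, none, some 1⟩
  | r1 => ⟨some 21, none, some 20, none⟩
  | r2 => ⟨none, some 22, some 21, none⟩
  | r3 => ⟨some 29, none, none, some 22⟩
  | s0 => ⟨some 23, none, none, some 1⟩
  | s1 => ⟨none, some 24, some 23, none⟩
  | s2 => ⟨none, none, some 25, some 24⟩
  | s3 => ⟨some 25, some 0, none, none⟩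
  | t0 => ⟨some 26, none, none, some 1⟩
  | t1 => ⟨none, some 27, some 26, none⟩
  | t2 => ⟨none, none, some 28, some 27⟩
  | t3 => ⟨some 28, some 0, none, none⟩

/-- The vector towards the neighbouring motif, or zero if the tile joins no other motif. -/
def port : Role → ℤ × ℤ
  | c0 | a0 | r0 | s0 | t0 => (-1, 0)
  | c3 | a4 | l0 | s3 | t3 => (1, 0)
  | c4 | c5 => (0, -1)
  | l3 | r3 => (0, 1)
  | _ => (0, 0)

/-- The tile `k` of a core or apex and the tile `k'` of a link carry the same outer glue. -/
def Mates (k k' : Role) : Prop :=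
  ((k = c0 ∨ k = a0) ∧ (k' = l0 ∨ k' = s3 ∨ k' = t3)) ∨
  ((k = c3 ∨ k = a4) ∧ (k' = r0 ∨ k' = s0 ∨ k' = t0)) ∨
  (k = c5 ∧ k' = l3) ∨ (k = c4 ∧ k' = r3)

instance (k k' : Role) : Decidable (Mates k k') := by unfold Mates; infer_instance

theorem type_injective : Function.Injective type := by
  intro k k' h
  revert k k'
  decide

end Role

open Role

/-- Weak are the outer glues `0, 1, 2, 29`, the core cycle `3`–`8` and the seams `9, 10` between the
two halves of the apex. The glues inside a link or inside half an apex are strong. -/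
def sierpinskiStr (g : ℕ) : ℕ := if g ≤ 10 ∨ g = 29 then 1 else 2

/-- A finite check that no glue binds in an unintended place: an inner glue fixes the relative
position inside one motif, and an outer glue is weak and joins a body to a link. -/
theorem east_west_mates : ∀ k k' : Role, glueStrength sierpinskiStr k.type.east k'.type.west ≠ 0 →
    (k.motif = k'.motif ∧ k'.off = k.off + (1, 0)) ∨
      ((Mates k k' ∨ Mates k' k) ∧ k.port = (1, 0) ∧ k'.port = (-1, 0) ∧
        glueStrength sierpinskiStr k.type.east k'.type.west ≤ 1) := by
  decide

theorem north_south_mates : ∀ k k' : Role,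
    glueStrength sierpinskiStr k.type.north k'.type.south ≠ 0 →
    (k.motif = k'.motif ∧ k'.off = k.off + (0, 1)) ∨
      ((Mates k k' ∨ Mates k' k) ∧ k.port = (0, 1) ∧ k'.port = (0, -1) ∧
        glueStrength sierpinskiStr k.type.north k'.type.south ≤ 1) := by
  decide

/-! ### Bonds, cuts and stability in general -/

theorem exists_two_of_two_le_sum {ι : Type*} (s : Finset ι) (f : ι → ℕ)
    (h : 2 ≤ ∑ i ∈ s, f i) :
    (∃ i ∈ s, 2 ≤ f i) ∨ ∃ i ∈ s, ∃ j ∈ s, i ≠ j ∧ f i ≠ 0 ∧ f j ≠ 0 := by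
  by_contra! hc
  obtain ⟨h1, h2⟩ := hc
  obtain ⟨i, hi, hi0⟩ : ∃ i ∈ s, f i ≠ 0 := by
    by_contra! h0
    rw [Finset.sum_eq_zero h0] at h
    omega
  rw [Finset.sum_eq_single_of_mem i hi fun j hj hne => h2 i hi j hj hne.symm hi0] at h
  exact absurd (h1 i hi) (by omega)

theorem glueStrength_comm (str : ℕ → ℕ) (a b : Option ℕ) :
    glueStrength str a b = glueStrength str b a := by
  rcases a with _ | a <;> rcases b with _ | b <;> simp only [glueStrength]
  by_cases h : a = b
  · simp [h]
  · simp [h, Ne.symm h]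

theorem bond_comm (str : ℕ → ℕ) (x y : PlacedTile) : bond str x y = bond str y x := by
  unfold bond
  have hx : ∀ u v : ℤ × ℤ, u = v + (1, 0) → ¬ v = u + (1, 0) := by
    rintro ⟨a, b⟩ ⟨c, d⟩ h h'
    simp only [Prod.mk_add_mk, Prod.mk.injEq] at h h'
    omega
  have hy : ∀ u v : ℤ × ℤ, u = v + (0, 1) → ¬ v = u + (0, 1) := by
    rintro ⟨a, b⟩ ⟨c, d⟩ h h'
    simp only [Prod.mk_add_mk, Prod.mk.injEq] at h h'
    omega
  have h1 := hx x.1 y.1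
  have h2 := hy x.1 y.1
  simp only [glueStrength_comm str x.2.east, glueStrength_comm str x.2.west,
    glueStrength_comm str x.2.north, glueStrength_comm str x.2.south]
  split_ifs <;> first | rfl | (exfalso; tauto)

theorem bond_translate (str : ℕ → ℕ) (v : ℤ × ℤ) (x y : PlacedTile) :
    bond str (x.1 + v, x.2) (y.1 + v, y.2) = bond str x y := by
  simp only [bond, add_right_comm _ v, add_left_inj]

theorem translate_injective (v : ℤ × ℤ) :
    Function.Injective (fun x : PlacedTile => ((x.1 + v, x.2) : PlacedTile)) := by
  rintro ⟨p, t⟩ ⟨q, u⟩ h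
  simpa using h

theorem mem_translateBy {v : ℤ × ℤ} {A : Assembly} {x : PlacedTile} :
    x ∈ translateBy v A ↔ (x.1 - v, x.2) ∈ A := by
  simp only [translateBy, Finset.mem_image]
  constructor
  · rintro ⟨y, hy, rfl⟩
    simpa using hy
  · exact fun h => ⟨_, h, by simp⟩

theorem translateBy_zero (A : Assembly) : translateBy 0 A = A := by
  ext x
  simp [mem_translateBy]

theorem shape_mono {A B : Assembly} (h : A ⊆ B) : shape A ⊆ shape B :=
  fun _ ⟨x, hx, hp⟩ => ⟨x, h hx, hp⟩

theorem mem_shape_of_mem {A : Assembly} {x : PlacedTile} (h : x ∈ A) : x.1 ∈ shape A :=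
  ⟨x, h, rfl⟩

theorem Stable.translateBy {str : ℕ → ℕ} {τ : ℕ} {A : Assembly} (h : Stable str τ A)
    (v : ℤ × ℤ) : Stable str τ (translateBy v A) := by
  obtain ⟨h1, h2, h3⟩ := h
  refine ⟨?_, h2.image _, ?_⟩
  · intro x hx y hy hxy
    have := h1 _ (mem_translateBy.1 hx) _ (mem_translateBy.1 hy) (by simp [hxy])
    simp only [Prod.mk.injEq] at this
    exact Prod.ext hxy this.2
  · intro X hX hne hXA
    obtain ⟨X, hXsub, rfl⟩ := Finset.subset_image_iff.1 hX
    have := h3 X hXsub (by simpa using hne) (by rintro rfl; exact hXA rfl)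
    unfold _root_.translateBy
    rw [← Finset.image_sdiff _ _ (translate_injective v),
      Finset.sum_image (fun _ _ _ _ h => translate_injective v h)]
    refine this.trans (Finset.sum_le_sum fun x _ => ?_)
    rw [Finset.sum_image (fun _ _ _ _ h => translate_injective v h)]
    exact Finset.sum_le_sum fun y _ => (bond_translate str v x y).ge

theorem stable_singleton (str : ℕ → ℕ) (τ : ℕ) (x : PlacedTile) : Stable str τ {x} := by
  refine ⟨?_, Finset.singleton_nonempty x, ?_⟩
  · simp [IsAssembly]
  · intro X hX hne hXA
    exact absurd (hne.subset_singleton_iff.1 hX) hXA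

/-- A cut of a `2`-stable assembly is crossed by a strong bond or by two bonds. -/
theorem Stable.exists_bonds {str : ℕ → ℕ} {A X : Assembly} (h : Stable str 2 A) (hX : X ⊆ A)
    (hne : X.Nonempty) (hXA : X ≠ A) :
    (∃ x ∈ X, ∃ y ∈ A, y ∉ X ∧ 2 ≤ bond str x y) ∨
    ∃ x ∈ X, ∃ y ∈ A, y ∉ X ∧ ∃ x' ∈ X, ∃ y' ∈ A, y' ∉ X ∧ (x ≠ x' ∨ y ≠ y') ∧
      bond str x y ≠ 0 ∧ bond str x' y' ≠ 0 := by
  have := h.2.2 X hX hne hXA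
  rw [← Finset.sum_product' X (A \ X) (bond str)] at this
  rcases exists_two_of_two_le_sum _ _ this with ⟨z, hz, hb⟩ | ⟨z, hz, w, hw, hne, h1, h2⟩
  · simp only [Finset.mem_product, Finset.mem_sdiff] at hz
    exact .inl ⟨z.1, hz.1, z.2, hz.2.1, hz.2.2, hb⟩
  · simp only [Finset.mem_product, Finset.mem_sdiff] at hz hw
    refine .inr ⟨z.1, hz.1, z.2, hz.2.1, hz.2.2, w.1, hw.1, w.2, hw.2.1, hw.2.2, ?_, h1, h2⟩
    by_contra! hc
    exact hne (Prod.ext hc.1 hc.2)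

/-- Stable assemblies whose mutual bonds hold every cut between them form a stable assembly. -/
theorem stable_biUnion {str : ℕ → ℕ} {τ : ℕ} {ι : Type*} [Fintype ι] [DecidableEq ι] [Nonempty ι]
    (F : ι → Assembly) (w : ι → ι → ℕ) (hF : ∀ i, Stable str τ (F i))
    (hd : ∀ i j, i ≠ j → Disjoint (shape (F i)) (shape (F j)))
    (hw : ∀ i j, w i j ≤ ∑ x ∈ F i, ∑ y ∈ F j, bond str x y)
    (hcut : ∀ s : Finset ι, s.Nonempty → s ≠ Finset.univ → τ ≤ ∑ i ∈ s, ∑ j ∈ sᶜ, w i j) :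
    Stable str τ (Finset.univ.biUnion F) := by
  have hdj : ∀ i j, i ≠ j → Disjoint (F i) (F j) := fun i j hij =>
    Finset.disjoint_left.2 fun x hx hy =>
      Set.disjoint_left.1 (hd i j hij) (mem_shape_of_mem hx) (mem_shape_of_mem hy)
  refine ⟨?_, ?_, ?_⟩
  · intro x hx y hy hxy
    simp only [Finset.mem_biUnion, Finset.mem_univ, true_and] at hx hy
    obtain ⟨i, hi⟩ := hx
    obtain ⟨j, hj⟩ := hy
    by_cases hij : i = j
    · subst hij
      exact (hF i).1 x hi y hj hxy
    · exact absurd (hxy ▸ mem_shape_of_mem hj)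
        (Set.disjoint_left.1 (hd i j hij) (mem_shape_of_mem hi))
  · obtain ⟨i⟩ := ‹Nonempty ι›
    exact (hF i).2.1.mono (Finset.subset_biUnion_of_mem F (Finset.mem_univ i))
  · intro X hX hne hXA
    -- A cut that splits some piece is already paid for by the stability of that piece. Any other
    -- cut is a union of whole pieces, and then `hcut` applies.
    by_cases hsplit : ∃ i, (X ∩ F i).Nonempty ∧ X ∩ F i ≠ F i
    · obtain ⟨i, h1, h2⟩ := hsplit
      refine ((hF i).2.2 _ Finset.inter_subset_right h1 h2).trans ?_
      refine (Finset.sum_le_sum_of_subset (f := fun x => ∑ y ∈ F i \ (X ∩ F i), bond str x y)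
        Finset.inter_subset_left).trans (Finset.sum_le_sum fun x _ => ?_)
      refine Finset.sum_le_sum_of_subset fun y hy => ?_
      simp only [Finset.mem_sdiff, Finset.mem_inter, not_and_or] at hy ⊢
      exact ⟨Finset.mem_biUnion.2 ⟨i, Finset.mem_univ i, hy.1⟩, hy.2.resolve_right (· hy.1)⟩
    · push Not at hsplit
      set s : Finset ι := Finset.univ.filter fun i => F i ⊆ X with hs
      have hmem : ∀ i, i ∉ s → Disjoint X (F i) := by
        intro i hi
        rw [Finset.disjoint_iff_inter_eq_empty]
        by_contra h0
        refine hi (Finset.mem_filter.2 ⟨Finset.mem_univ i, ?_⟩)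
        exact Finset.inter_eq_right.1 (hsplit i (Finset.nonempty_iff_ne_empty.2 h0))
      have hXs : X = s.biUnion F := by
        ext x
        simp only [Finset.mem_biUnion]
        constructor
        · intro hx
          obtain ⟨i, -, hi⟩ := Finset.mem_biUnion.1 (hX hx)
          by_cases his : i ∈ s
          · exact ⟨i, his, hi⟩
          · exact absurd hi (Finset.disjoint_left.1 (hmem i his) hx)
        · rintro ⟨i, hi, hx⟩
          exact (Finset.mem_filter.1 hi).2 hx
      have hCs : Finset.univ.biUnion F \ X = sᶜ.biUnion F := by
        ext x
        simp only [Finset.mem_biUnion, Finset.mem_sdiff, Finset.mem_univ, true_and,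
          Finset.mem_compl]
        constructor
        · rintro ⟨⟨i, hi⟩, hx⟩
          exact ⟨i, fun his => hx ((Finset.mem_filter.1 his).2 hi), hi⟩
        · rintro ⟨i, his, hi⟩
          exact ⟨⟨i, hi⟩, fun hx => Finset.disjoint_left.1 (hmem i his) hx hi⟩
      have hsne : s.Nonempty := by
        obtain ⟨x, hx⟩ := hne
        rw [hXs, Finset.mem_biUnion] at hx
        obtain ⟨i, hi, -⟩ := hx
        exact ⟨i, hi⟩
      have hsu : s ≠ Finset.univ := by
        intro h
        rw [h] at hXs
        exact hXA hXs
      rw [hCs, hXs, Finset.sum_biUnion fun i _ j _ hij => hdj i j hij]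
      refine (hcut s hsne hsu).trans (Finset.sum_le_sum fun i _ => ?_)
      have : ∑ x ∈ F i, ∑ y ∈ sᶜ.biUnion F, bond str x y =
          ∑ j ∈ sᶜ, ∑ x ∈ F i, ∑ y ∈ F j, bond str x y := by
        rw [Finset.sum_comm (s := sᶜ)]
        refine Finset.sum_congr rfl fun x _ => ?_
        rw [Finset.sum_biUnion fun i _ j _ hij => hdj i j hij]
      rw [this]
      exact Finset.sum_le_sum fun j _ => hw i j

theorem le_sum_bond {str : ℕ → ℕ} {A B : Assembly} {x y : PlacedTile} (hx : x ∈ A) (hy : y ∈ B) :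
    bond str x y ≤ ∑ x ∈ A, ∑ y ∈ B, bond str x y :=
  (Finset.single_le_sum (f := fun y => bond str x y) (fun _ _ => Nat.zero_le _) hy).trans
    (Finset.single_le_sum (f := fun x => ∑ y ∈ B, bond str x y) (fun _ _ => Nat.zero_le _) hx)

/-! ### Motifs as placed assemblies and their stability -/

/-- The tile `k` of the motif with origin `q`. -/
def pt (k : Role) (q : ℤ × ℤ) : PlacedTile := (q + k.off, k.type)

theorem off_injective : ∀ k k' : Role, k.motif = k'.motif → k.off = k'.off → k = k' := by
  decide

theorem pt_inj {k k' : Role} {q q' : ℤ × ℤ} : pt k q = pt k' q' ↔ k = k' ∧ q = q' := by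
  constructor
  · intro h
    simp only [pt, Prod.mk.injEq] at h
    have hk := type_injective h.2
    subst hk
    exact ⟨rfl, add_right_cancel h.1⟩
  · rintro ⟨rfl, rfl⟩
    rfl

/-- The tiles of a set of roles, placed with the motif origin `q`. -/
def place (M : Finset Role) (q : ℤ × ℤ) : Assembly := M.image fun k => pt k q

/-- The complete motif `m` with origin `q`. -/
def inst (m : Motif) (q : ℤ × ℤ) : Assembly :=
  place (Finset.univ.filter fun k => k.motif = m) q

theorem mem_place {M : Finset Role} {q : ℤ × ℤ} {x : PlacedTile} :
    x ∈ place M q ↔ ∃ k ∈ M, pt k q = x := by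
  simp [place]

theorem pt_mem_place {M : Finset Role} {k : Role} {q q' : ℤ × ℤ} :
    pt k q' ∈ place M q ↔ k ∈ M ∧ q' = q := by
  simp only [mem_place, pt_inj]
  constructor
  · rintro ⟨k, hk, rfl, rfl⟩
    exact ⟨hk, rfl⟩
  · rintro ⟨hk, rfl⟩
    exact ⟨k, hk, rfl, rfl⟩

theorem mem_inst {m : Motif} {q : ℤ × ℤ} {x : PlacedTile} :
    x ∈ inst m q ↔ ∃ k : Role, k.motif = m ∧ pt k q = x := by
  simp [inst, mem_place]

theorem pt_mem_inst {m : Motif} {k : Role} {q q' : ℤ × ℤ} :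
    pt k q' ∈ inst m q ↔ k.motif = m ∧ q' = q := by
  simp [inst, pt_mem_place]

theorem translateBy_place (v : ℤ × ℤ) (M : Finset Role) (q : ℤ × ℤ) :
    translateBy v (place M q) = place M (q + v) := by
  unfold translateBy place
  rw [Finset.image_image]
  congr 1
  funext k
  simp [pt, add_right_comm]

theorem bond_pt_self (k k' : Role) (q : ℤ × ℤ) :
    bond sierpinskiStr (pt k q) (pt k' q) = bond sierpinskiStr (pt k 0) (pt k' 0) := by
  rw [← bond_translate _ q (pt k 0) (pt k' 0)]
  simp [pt, add_comm q]

/-- Two tiles that bind belong to the same motif or join two motifs by a weak outer glue. -/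
theorem bond_pt {k k' : Role} {q q' : ℤ × ℤ}
    (h : bond sierpinskiStr (pt k q) (pt k' q') ≠ 0) :
    (k.motif = k'.motif ∧ q = q') ∨
      ((Mates k k' ∨ Mates k' k) ∧ q' + k'.off = q + k.off + k.port ∧
        q + k.off = q' + k'.off + k'.port ∧ bond sierpinskiStr (pt k q) (pt k' q') ≤ 1) := by
  have neg1 : ((1 : ℤ), (0 : ℤ)) + (-1, 0) = 0 := rfl
  have neg3 : ((0 : ℤ), (1 : ℤ)) + (0, -1) = 0 := rfl
  have hb : bond sierpinskiStr (pt k q) (pt k' q') =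
      if q' + k'.off = q + k.off + (1, 0) then
        glueStrength sierpinskiStr k.type.east k'.type.west
      else if q + k.off = q' + k'.off + (1, 0) then
        glueStrength sierpinskiStr k.type.west k'.type.east
      else if q' + k'.off = q + k.off + (0, 1) then
        glueStrength sierpinskiStr k.type.north k'.type.south
      else if q + k.off = q' + k'.off + (0, 1) then
        glueStrength sierpinskiStr k.type.south k'.type.north
      else 0 := rfl
  rw [hb] at h ⊢
  by_cases h1 : q' + k'.off = q + k.off + (1, 0)
  · rw [if_pos h1] at h ⊢
    rcases east_west_mates k k' h with ⟨hm, ho⟩ | ⟨hm, hp, hp', hs⟩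
    · rw [ho, add_assoc q] at h1
      exact .inl ⟨hm, (add_right_cancel h1).symm⟩
    · exact .inr ⟨hm, by rw [h1, hp], by rw [h1, hp', add_assoc _ (1, 0), neg1, add_zero], hs⟩
  rw [if_neg h1] at h ⊢
  by_cases h2 : q + k.off = q' + k'.off + (1, 0)
  · rw [if_pos h2, glueStrength_comm] at h ⊢
    rcases east_west_mates k' k h with ⟨hm, ho⟩ | ⟨hm, hp, hp', hs⟩
    · rw [ho, add_assoc q'] at h2
      exact .inl ⟨hm.symm, add_right_cancel h2⟩
    · exact .inr ⟨hm.symm, by rw [h2, hp', add_assoc _ (1, 0), neg1, add_zero], by rw [h2, hp],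
        hs⟩
  rw [if_neg h2] at h ⊢
  by_cases h3 : q' + k'.off = q + k.off + (0, 1)
  · rw [if_pos h3] at h ⊢
    rcases north_south_mates k k' h with ⟨hm, ho⟩ | ⟨hm, hp, hp', hs⟩
    · rw [ho, add_assoc q] at h3
      exact .inl ⟨hm, (add_right_cancel h3).symm⟩
    · exact .inr ⟨hm, by rw [h3, hp], by rw [h3, hp', add_assoc _ (0, 1), neg3, add_zero], hs⟩
  rw [if_neg h3] at h ⊢
  by_cases h4 : q + k.off = q' + k'.off + (0, 1)
  · rw [if_pos h4, glueStrength_comm] at h ⊢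
    rcases north_south_mates k' k h with ⟨hm, ho⟩ | ⟨hm, hp, hp', hs⟩
    · rw [ho, add_assoc q'] at h4
      exact .inl ⟨hm.symm, add_right_cancel h4⟩
    · exact .inr ⟨hm.symm, by rw [h4, hp', add_assoc _ (0, 1), neg3, add_zero], by rw [h4, hp],
        hs⟩
  rw [if_neg h4] at h
  exact absurd rfl h

theorem stable_pair {A B : Assembly} (hA : Stable sierpinskiStr 2 A)
    (hB : Stable sierpinskiStr 2 B) (hd : Disjoint (shape A) (shape B))
    (hb : 2 ≤ ∑ x ∈ A, ∑ y ∈ B, bond sierpinskiStr x y) : Stable sierpinskiStr 2 (A ∪ B) := by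
  have hb' : 2 ≤ ∑ x ∈ B, ∑ y ∈ A, bond sierpinskiStr x y := by
    rw [Finset.sum_comm]
    simpa only [bond_comm] using hb
  have := stable_biUnion (τ := 2) (fun i : Bool => if i then A else B)
    (fun i j => if i = j then 0 else 2)
    (by rintro (_ | _) <;> simpa) (by rintro (_ | _) (_ | _) h <;> simp_all [hd.symm])
    (by rintro (_ | _) (_ | _) <;> simp_all) (by decide)
  convert this using 1
  ext x
  simp

/-- A proper nonempty subset of a cycle has at least two boundary edges. The same lemma serves for
the six tiles of a core and for the six pieces of a stage. -/
theorem stable_cycle (F : Fin 6 → Assembly) (hF : ∀ i, Stable sierpinskiStr 2 (F i))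
    (hd : ∀ i j, i ≠ j → Disjoint (shape (F i)) (shape (F j)))
    (hb : ∀ i, 1 ≤ ∑ x ∈ F i, ∑ y ∈ F (i + 1), bond sierpinskiStr x y) :
    Stable sierpinskiStr 2 (Finset.univ.biUnion F) := by
  refine stable_biUnion (τ := 2) F (fun i j => if j = i + 1 ∨ i = j + 1 then 1 else 0) hF hd ?_ ?_
  · intro i j
    split_ifs with h
    · rcases h with rfl | rfl
      · exact hb i
      · rw [Finset.sum_comm]
        simpa only [bond_comm] using hb j
    · exact Nat.zero_le _
  · decide

theorem disjoint_shape_singleton {k k' : Role} (q : ℤ × ℤ) (hm : k.motif = k'.motif)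
    (hne : k ≠ k') : Disjoint (shape {pt k q}) (shape {pt k' q}) := by
  rw [Set.disjoint_left]
  rintro p ⟨x, hx, rfl⟩ ⟨y, hy, h⟩
  rw [Finset.mem_singleton] at hx hy
  subst hx hy
  exact hne (off_injective k k' hm (add_left_cancel h.symm))

theorem disjoint_shape_place {M M' : Finset Role} (q : ℤ × ℤ) {m : Motif}
    (hM : ∀ k ∈ M, k.motif = m) (hM' : ∀ k ∈ M', k.motif = m) (hne : Disjoint M M') :
    Disjoint (shape (place M q)) (shape (place M' q)) := by
  rw [Set.disjoint_left]
  rintro p ⟨x, hx, rfl⟩ ⟨y, hy, h⟩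
  obtain ⟨k, hk, rfl⟩ := mem_place.1 hx
  obtain ⟨k', hk', rfl⟩ := mem_place.1 hy
  have := off_injective k k' ((hM k hk).trans (hM' k' hk').symm) (add_left_cancel h.symm)
  subst this
  exact Finset.disjoint_left.1 hne hk hk'

theorem stable_place_insert {M : Finset Role} {k k' : Role} {q : ℤ × ℤ} {m : Motif}
    (hM : Stable sierpinskiStr 2 (place M q)) (hm : ∀ k ∈ M, k.motif = m) (hk : k.motif = m)
    (hkM : k ∉ M) (hk' : k' ∈ M) (hb : 2 ≤ bond sierpinskiStr (pt k 0) (pt k' 0)) :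
    Stable sierpinskiStr 2 (place (insert k M) q) := by
  have h1 : place {k} q = {pt k q} := by simp [place]
  have : place (insert k M) q = place {k} q ∪ place M q := by
    ext x
    simp [place]
  rw [this]
  refine stable_pair (h1 ▸ stable_singleton _ _ _) hM
    (disjoint_shape_place q (m := m) (by simpa using hk) hm (by simpa using hkM)) ?_
  rw [← bond_pt_self k k' q] at hb
  exact hb.trans (le_sum_bond (pt_mem_place.2 ⟨by simp, rfl⟩) (pt_mem_place.2 ⟨hk', rfl⟩))

/-- Four tiles of a motif that are joined to a path by strong bonds. -/
theorem stable_path (m : Motif) (i j k l : Role) (q : ℤ × ℤ) (hi : i.motif = m) (hj : j.motif = m)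
    (hk : k.motif = m) (hl : l.motif = m) (hnd : [i, j, k, l].Nodup)
    (hij : 2 ≤ bond sierpinskiStr (pt i 0) (pt j 0))
    (hjk : 2 ≤ bond sierpinskiStr (pt j 0) (pt k 0))
    (hkl : 2 ≤ bond sierpinskiStr (pt k 0) (pt l 0)) :
    Stable sierpinskiStr 2 (place {i, j, k, l} q) := by
  simp only [List.nodup_cons, List.mem_cons, not_or, List.not_mem_nil] at hnd
  refine stable_place_insert (m := m) (k' := j) (stable_place_insert (m := m) (k' := k)
    (stable_place_insert (m := m) (k' := l) ?_ ?_ hk ?_ ?_ hkl) ?_ hj ?_ ?_ hjk) ?_ hi ?_ ?_ hij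
  · have : place {l} q = {pt l q} := by simp [place]
    exact this ▸ stable_singleton _ _ _
  all_goals simp_all

theorem inst_left (q : ℤ × ℤ) : inst .left q = place {l0, l1, l2, l3} q :=
  congrArg (place · q) (by decide)

theorem inst_right (q : ℤ × ℤ) : inst .right q = place {r0, r1, r2, r3} q :=
  congrArg (place · q) (by decide)

theorem inst_top (q : ℤ × ℤ) : inst .top q = place {s0, s1, s2, s3} q :=
  congrArg (place · q) (by decide)

theorem inst_top' (q : ℤ × ℤ) : inst .top' q = place {t0, t1, t2, t3} q :=
  congrArg (place · q) (by decide)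

theorem inst_core (q : ℤ × ℤ) : inst .core q = place {c0, c1, c2, c3, c4, c5} q :=
  congrArg (place · q) (by decide)

theorem inst_apex (q : ℤ × ℤ) :
    inst .apex q = place {a0, a1, a2, a3} q ∪ place {a4, a5, a6, a7} q := by
  unfold place
  rw [← Finset.image_union]
  exact congrArg (place · q) (by decide)

theorem stable_apex_left (q : ℤ × ℤ) : Stable sierpinskiStr 2 (place {a0, a1, a2, a3} q) := by
  have := stable_path .apex a1 a0 a2 a3 q rfl rfl rfl rfl (by decide) (by decide) (by decide)
    (by decide)
  rwa [show ({a1, a0, a2, a3} : Finset Role) = {a0, a1, a2, a3} by decide] at this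

theorem stable_apex_right (q : ℤ × ℤ) : Stable sierpinskiStr 2 (place {a4, a5, a6, a7} q) := by
  have := stable_path .apex a5 a4 a6 a7 q rfl rfl rfl rfl (by decide) (by decide) (by decide)
    (by decide)
  rwa [show ({a5, a4, a6, a7} : Finset Role) = {a4, a5, a6, a7} by decide] at this

theorem disjoint_apex_halves (q : ℤ × ℤ) :
    Disjoint (shape (place {a0, a1, a2, a3} q)) (shape (place {a4, a5, a6, a7} q)) :=
  disjoint_shape_place q (m := .apex) (by decide) (by decide) (by decide)

/-- The core is a cycle of weak bonds, the apex is two stable halves with two weak bonds between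
them, and the links are paths of strong bonds. -/
theorem stable_inst (m : Motif) (q : ℤ × ℤ) : Stable sierpinskiStr 2 (inst m q) := by
  cases m
  · let e : Fin 6 → Role := ![c0, c1, c2, c3, c4, c5]
    have he : ∀ i, (e i).motif = .core := by decide
    have hinj : ∀ i j, i ≠ j → e i ≠ e j := by decide
    have hb : ∀ i, 1 ≤ bond sierpinskiStr (pt (e i) 0) (pt (e (i + 1)) 0) := by decide
    have := stable_cycle (fun i => {pt (e i) q}) (fun i => stable_singleton _ _ _)
      (fun i j hij => disjoint_shape_singleton q ((he i).trans (he j).symm) (hinj i j hij))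
      (fun i => by simpa [bond_pt_self] using hb i)
    convert this using 1
    rw [inst_core]
    unfold place
    rw [show ({c0, c1, c2, c3, c4, c5} : Finset Role) = Finset.univ.image e by decide,
      Finset.image_image]
    ext x
    simp [eq_comm]
  · rw [inst_apex]
    refine stable_pair (stable_apex_left q) (stable_apex_right q) (disjoint_apex_halves q) ?_
    calc 2 ≤ ∑ x ∈ place {a0, a1, a2, a3} 0, ∑ y ∈ place {a4, a5, a6, a7} 0,
          bond sierpinskiStr x y := by decide
      _ = _ := by
        rw [← zero_add q, ← translateBy_place, ← translateBy_place]
        unfold translateBy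
        rw [Finset.sum_image (fun _ _ _ _ h => translate_injective q h)]
        refine Finset.sum_congr rfl fun x _ => ?_
        rw [Finset.sum_image (fun _ _ _ _ h => translate_injective q h)]
        exact Finset.sum_congr rfl fun y _ => (bond_translate _ q x y).symm
  · rw [inst_left]
    exact stable_path .left l0 l1 l2 l3 q rfl rfl rfl rfl (by decide) (by decide) (by decide)
      (by decide)
  · rw [inst_right]
    exact stable_path .right r0 r1 r2 r3 q rfl rfl rfl rfl (by decide) (by decide) (by decide)
      (by decide)
  · rw [inst_top]
    exact stable_path .top s0 s1 s2 s3 q rfl rfl rfl rfl (by decide) (by decide) (by decide)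
      (by decide)
  · rw [inst_top']
    exact stable_path .top' t0 t1 t2 t3 q rfl rfl rfl rfl (by decide) (by decide) (by decide)
      (by decide)

/-! ### Stable parts of a motif -/

/-- A tile of a stable part of a motif is held by a strong bond or by two bonds. -/
theorem Stable.exists_bonds_of_pt {U : Assembly} {M : Finset Role} {q : ℤ × ℤ} {k : Role}
    (hU : Stable sierpinskiStr 2 U) (hUm : U ⊆ place M q) (hk : pt k q ∈ U) (hne : U ≠ {pt k q}) :
    (∃ i, pt i q ∈ U ∧ 2 ≤ bond sierpinskiStr (pt k 0) (pt i 0)) ∨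
      ∃ i j, pt i q ∈ U ∧ pt j q ∈ U ∧ i ≠ j ∧ bond sierpinskiStr (pt k 0) (pt i 0) ≠ 0 ∧
        bond sierpinskiStr (pt k 0) (pt j 0) ≠ 0 := by
  have hrole : ∀ y ∈ U, ∃ i, pt i q = y := fun y hy =>
    let ⟨i, _, h⟩ := mem_place.1 (hUm hy)
    ⟨i, h⟩
  rcases hU.exists_bonds (Finset.singleton_subset_iff.2 hk) (Finset.singleton_nonempty _) hne.symm
    with ⟨x, hx, y, hy, -, hb⟩ | ⟨x, hx, y, hy, -, x', hx', y', hy', -, hd, hb, hb'⟩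
  · obtain ⟨i, rfl⟩ := hrole y hy
    rw [Finset.mem_singleton.1 hx, bond_pt_self] at hb
    exact .inl ⟨i, hy, hb⟩
  · obtain ⟨i, rfl⟩ := hrole y hy
    obtain ⟨j, rfl⟩ := hrole y' hy'
    rw [Finset.mem_singleton.1 hx, bond_pt_self] at hb
    rw [Finset.mem_singleton.1 hx', bond_pt_self] at hb'
    rw [Finset.mem_singleton.1 hx, Finset.mem_singleton.1 hx'] at hd
    refine .inr ⟨i, j, hy, hy', ?_, hb, hb'⟩
    rintro rfl
    simp at hd

theorem Stable.pt_mem_of_unique_bond {U : Assembly} {M : Finset Role} {q : ℤ × ℤ} {k k' i : Role}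
    (hU : Stable sierpinskiStr 2 U) (hUm : U ⊆ place M q) (hk : pt k q ∈ U) (hk' : pt k' q ∈ U)
    (hne : k ≠ k')
    (hb : ∀ j, bond sierpinskiStr (pt k 0) (pt j 0) ≠ 0 → j = i) : pt i q ∈ U := by
  have hUk : U ≠ {pt k q} := by
    rintro rfl
    exact hne (pt_inj.1 (Finset.mem_singleton.1 hk')).1.symm
  rcases hU.exists_bonds_of_pt hUm hk hUk with ⟨j, hj, h⟩ | ⟨j, -, hj, -, -, h, -⟩
  · exact hb j (by omega) ▸ hj
  · exact hb j h ▸ hj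

/-- The bond to `j` is too weak to hold `k` alone, so the other possible neighbour `i` must be
present. -/
theorem Stable.pt_mem_of_two_bonds {U : Assembly} {M : Finset Role} {q : ℤ × ℤ} {k k' i j : Role}
    (hU : Stable sierpinskiStr 2 U) (hUm : U ⊆ place M q) (hk : pt k q ∈ U) (hk' : pt k' q ∈ U)
    (hne : k ≠ k') (hb : ∀ l, bond sierpinskiStr (pt k 0) (pt l 0) ≠ 0 → l = i ∨ l = j)
    (hj : bond sierpinskiStr (pt k 0) (pt j 0) ≤ 1) : pt i q ∈ U := by
  have hUk : U ≠ {pt k q} := by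
    rintro rfl
    exact hne (pt_inj.1 (Finset.mem_singleton.1 hk')).1.symm
  rcases hU.exists_bonds_of_pt hUm hk hUk with ⟨l, hl, h⟩ | ⟨l, l', hl, hl', hll, h, h'⟩
  · rcases hb l (by omega) with rfl | rfl
    · exact hl
    · omega
  · rcases hb l h with rfl | rfl
    · exact hl
    · rcases hb l' h' with rfl | rfl
      · exact hl'
      · exact absurd rfl hll

/-- An end of the path has only one neighbour to hold it. So the two ends, which carry the outer
glues of a link, bring in the two middle tiles. -/
theorem Stable.eq_path {U : Assembly} {q : ℤ × ℤ} {a b c d : Role}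
    (hU : Stable sierpinskiStr 2 U) (hUm : U ⊆ place {a, b, c, d} q) (ha : pt a q ∈ U)
    (hd : pt d q ∈ U) (hne : a ≠ d)
    (hab : ∀ j, bond sierpinskiStr (pt a 0) (pt j 0) ≠ 0 → j = b)
    (hdc : ∀ j, bond sierpinskiStr (pt d 0) (pt j 0) ≠ 0 → j = c) : U = place {a, b, c, d} q := by
  refine Finset.Subset.antisymm hUm fun x hx => ?_
  have hb := hU.pt_mem_of_unique_bond hUm ha hd hne hab
  have hc := hU.pt_mem_of_unique_bond hUm hd ha hne.symm hdc
  obtain ⟨k, hk, rfl⟩ := mem_place.1 hx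
  simp only [Finset.mem_insert, Finset.mem_singleton] at hk
  rcases hk with rfl | rfl | rfl | rfl <;> assumption

theorem Stable.eq_left {U : Assembly} {q : ℤ × ℤ} (hU : Stable sierpinskiStr 2 U)
    (hUm : U ⊆ inst .left q) (h0 : pt l0 q ∈ U) (h3 : pt l3 q ∈ U) : U = inst .left q := by
  rw [inst_left] at hUm ⊢
  exact hU.eq_path hUm h0 h3 (by decide) (by decide) (by decide)

theorem Stable.eq_right {U : Assembly} {q : ℤ × ℤ} (hU : Stable sierpinskiStr 2 U)
    (hUm : U ⊆ inst .right q) (h0 : pt r0 q ∈ U) (h3 : pt r3 q ∈ U) : U = inst .right q := by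
  rw [inst_right] at hUm ⊢
  exact hU.eq_path hUm h0 h3 (by decide) (by decide) (by decide)

theorem Stable.eq_top {U : Assembly} {q : ℤ × ℤ} (hU : Stable sierpinskiStr 2 U)
    (hUm : U ⊆ inst .top q) (h0 : pt s0 q ∈ U) (h3 : pt s3 q ∈ U) : U = inst .top q := by
  rw [inst_top] at hUm ⊢
  exact hU.eq_path hUm h0 h3 (by decide) (by decide) (by decide)

theorem Stable.eq_top' {U : Assembly} {q : ℤ × ℤ} (hU : Stable sierpinskiStr 2 U)
    (hUm : U ⊆ inst .top' q) (h0 : pt t0 q ∈ U) (h3 : pt t3 q ∈ U) : U = inst .top' q := by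
  rw [inst_top'] at hUm ⊢
  exact hU.eq_path hUm h0 h3 (by decide) (by decide) (by decide)

/-- With only weak bonds in the cycle, a tile that is not alone needs both of its neighbours, and
this propagates around the cycle. Hence an incomplete core is a single tile. -/
theorem Stable.eq_core {U : Assembly} {q : ℤ × ℤ} {k k' : Role} (hU : Stable sierpinskiStr 2 U)
    (hUm : U ⊆ inst .core q) (hk : pt k q ∈ U) (hk' : pt k' q ∈ U) (hne : k ≠ k') :
    U = inst .core q := by
  rw [inst_core] at hUm ⊢
  have hcl : ∀ i j l, pt i q ∈ U → (∀ l', bond sierpinskiStr (pt i 0) (pt l' 0) ≠ 0 →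
      l' = j ∨ l' = l) → bond sierpinskiStr (pt i 0) (pt l 0) ≤ 1 → pt j q ∈ U := by
    intro i j l hi hb hl
    by_cases hik : i = k
    · subst hik
      exact hU.pt_mem_of_two_bonds hUm hi hk' hne hb hl
    · exact hU.pt_mem_of_two_bonds hUm hi hk hik hb hl
  have h0 : pt c0 q ∈ U → pt c1 q ∈ U := fun h => hcl c0 c1 c5 h (by decide) (by decide)
  have h1 : pt c1 q ∈ U → pt c2 q ∈ U := fun h => hcl c1 c2 c0 h (by decide) (by decide)
  have h2 : pt c2 q ∈ U → pt c3 q ∈ U := fun h => hcl c2 c3 c1 h (by decide) (by decide)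
  have h3 : pt c3 q ∈ U → pt c4 q ∈ U := fun h => hcl c3 c4 c2 h (by decide) (by decide)
  have h4 : pt c4 q ∈ U → pt c5 q ∈ U := fun h => hcl c4 c5 c3 h (by decide) (by decide)
  have h5 : pt c5 q ∈ U → pt c0 q ∈ U := fun h => hcl c5 c0 c4 h (by decide) (by decide)
  refine Finset.Subset.antisymm hUm fun x hx => ?_
  obtain ⟨i, hi, rfl⟩ := mem_place.1 hx
  have hk0 := (pt_mem_place.1 (hUm hk)).1
  simp only [Finset.mem_insert, Finset.mem_singleton] at hi hk0
  have hc0 : pt c0 q ∈ U := by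
    rcases hk0 with rfl | rfl | rfl | rfl | rfl | rfl
    exacts [hk, h5 (h4 (h3 (h2 (h1 hk)))), h5 (h4 (h3 (h2 hk))), h5 (h4 (h3 hk)), h5 (h4 hk), h5 hk]
  have hc1 := h0 hc0
  have hc2 := h1 hc1
  have hc3 := h2 hc2
  have hc4 := h3 hc3
  rcases hi with rfl | rfl | rfl | rfl | rfl | rfl
  exacts [hc0, hc1, hc2, hc3, hc4, h4 hc4]

/-- If both halves occur, the cut between them needs both seams `a1`–`a5` and `a3`–`a7`. These four
tiles then force the rest. The two outer glues of the apex lie in different halves. -/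
theorem Stable.apex_cases {U : Assembly} {q : ℤ × ℤ} (hU : Stable sierpinskiStr 2 U)
    (hUm : U ⊆ inst .apex q) :
    U = inst .apex q ∨ U ⊆ place {a0, a1, a2, a3} q ∨ U ⊆ place {a4, a5, a6, a7} q := by
  by_cases hr : U ⊆ place {a4, a5, a6, a7} q
  · exact .inr (.inr hr)
  by_cases hl : U ⊆ place {a0, a1, a2, a3} q
  · exact .inr (.inl hl)
  left
  have key : pt a1 q ∈ U ∧ pt a5 q ∈ U ∧ pt a3 q ∈ U ∧ pt a7 q ∈ U := by
    have hne : (U ∩ place {a0, a1, a2, a3} q).Nonempty := by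
      obtain ⟨x, hx, hxr⟩ := Finset.not_subset.1 hr
      have := hUm hx
      rw [inst_apex, Finset.mem_union] at this
      exact ⟨x, Finset.mem_inter.2 ⟨hx, this.resolve_right hxr⟩⟩
    have hb : ∀ x ∈ U ∩ place {a0, a1, a2, a3} q, ∀ y ∈ U, y ∉ U ∩ place {a0, a1, a2, a3} q →
        ∃ i ∈ ({a0, a1, a2, a3} : Finset Role), ∃ j ∈ ({a4, a5, a6, a7} : Finset Role),
          pt i q = x ∧ pt j q = y := by
      intro x hx y hy hxy
      rw [Finset.mem_inter] at hx hxy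
      obtain ⟨i, hi, rfl⟩ := mem_place.1 hx.2
      have hy' := hUm hy
      rw [inst_apex, Finset.mem_union] at hy'
      obtain ⟨j, hj, rfl⟩ := mem_place.1 (hy'.resolve_left fun h => hxy ⟨hy, h⟩)
      exact ⟨i, hi, j, hj, rfl, rfl⟩
    have hw : ∀ i ∈ ({a0, a1, a2, a3} : Finset Role), ∀ j ∈ ({a4, a5, a6, a7} : Finset Role),
        bond sierpinskiStr (pt i 0) (pt j 0) ≠ 0 → bond sierpinskiStr (pt i 0) (pt j 0) ≤ 1 ∧
          ((i = a1 ∧ j = a5) ∨ (i = a3 ∧ j = a7)) := by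
      decide
    rcases hU.exists_bonds Finset.inter_subset_left hne
      (fun h => hl (Finset.inter_eq_left.1 h)) with
      ⟨x, hx, y, hy, hxy, h⟩ | ⟨x, hx, y, hy, hxy, x', hx', y', hy', hxy', hd, h, h'⟩
    · obtain ⟨i, hi, j, hj, rfl, rfl⟩ := hb x hx y hy hxy
      rw [bond_pt_self] at h
      have := (hw i hi j hj (by omega)).1
      omega
    · obtain ⟨i, hi, j, hj, rfl, rfl⟩ := hb x hx y hy hxy
      obtain ⟨i', hi', j', hj', rfl, rfl⟩ := hb x' hx' y' hy' hxy'
      rw [bond_pt_self] at h h'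
      have hx := (Finset.mem_inter.1 hx).1
      have hx' := (Finset.mem_inter.1 hx').1
      rcases (hw i hi j hj h).2 with ⟨rfl, rfl⟩ | ⟨rfl, rfl⟩ <;>
        rcases (hw i' hi' j' hj' h').2 with ⟨rfl, rfl⟩ | ⟨rfl, rfl⟩ <;> simp_all
  obtain ⟨h1, h5, h3, h7⟩ := key
  have h0 := hU.pt_mem_of_two_bonds (i := a0) (j := a5) hUm h1 h5 (by decide) (by decide)
    (by decide)
  have h4 := hU.pt_mem_of_two_bonds (i := a4) (j := a1) hUm h5 h1 (by decide) (by decide)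
    (by decide)
  have h2 := hU.pt_mem_of_two_bonds (i := a2) (j := a7) hUm h3 h5 (by decide) (by decide)
    (by decide)
  have h6 := hU.pt_mem_of_two_bonds (i := a6) (j := a3) hUm h7 h5 (by decide) (by decide)
    (by decide)
  refine Finset.Subset.antisymm hUm fun x hx => ?_
  rw [inst_apex, Finset.mem_union, mem_place, mem_place] at hx
  simp only [Finset.mem_insert, Finset.mem_singleton] at hx
  rcases hx with ⟨k, hk, rfl⟩ | ⟨k, hk, rfl⟩ <;> rcases hk with rfl | rfl | rfl | rfl <;> assumption

theorem Stable.eq_apex {U : Assembly} {q : ℤ × ℤ} (hU : Stable sierpinskiStr 2 U)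
    (hUm : U ⊆ inst .apex q) (h0 : pt a0 q ∈ U) (h4 : pt a4 q ∈ U) : U = inst .apex q := by
  rcases hU.apex_cases hUm with h | h | h
  · exact h
  · exact absurd (pt_mem_place.1 (h h4)).1 (by decide)
  · exact absurd (pt_mem_place.1 (h h0)).1 (by decide)

/-! ### The system and the production of motifs -/

def sierpinskiSystem : HAMSystem where
  tiles := Finset.univ.image Role.type
  str := sierpinskiStr
  temperature := 2
  temperature_pos := by decide
  hands := 6
  hands_pos := by decide

theorem card_tiles : sierpinskiSystem.tiles.card = 30 := by
  unfold sierpinskiSystem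
  rw [Finset.card_image_of_injective _ type_injective]
  rfl

theorem Producible.stable {A : Assembly} (h : Producible sierpinskiSystem A) :
    Stable sierpinskiStr 2 A := by
  cases h with
  | base t ht p => exact stable_singleton _ _ _
  | combine r hr F C hF hC =>
    obtain ⟨v, -, -, h⟩ := hC
    exact h

/-- Disjoint assemblies indexed by a type with at most six elements, with a stable union. -/
structure Joins {ι : Type*} [Fintype ι] (F : ι → Assembly) : Prop where
  card_le : Fintype.card ι ≤ 6
  disjoint : ∀ i j, i ≠ j → Disjoint (shape (F i)) (shape (F j))
  stable : Stable sierpinskiStr 2 (Finset.univ.biUnion F)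

theorem Joins.formsStable {ι : Type*} [Fintype ι] {F : ι → Assembly} (h : Joins F) :
    FormsStable sierpinskiStr 2 (fun i => F ((Fintype.equivFin ι).symm i))
      (Finset.univ.biUnion F) := by
  refine ⟨fun i j hij => h.disjoint _ _ fun h' => hij ((Equiv.injective _) h'), ?_, h.stable⟩
  ext x
  simp only [Finset.mem_biUnion, Finset.mem_univ, true_and]
  exact ⟨fun ⟨i, hi⟩ => ⟨Fintype.equivFin ι i, by simpa using hi⟩, fun ⟨i, hi⟩ => ⟨_, hi⟩⟩

theorem Joins.producible {ι : Type*} [Fintype ι] {F : ι → Assembly} (h : Joins F)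
    (hF : ∀ i, Producible sierpinskiSystem (F i)) :
    Producible sierpinskiSystem (Finset.univ.biUnion F) := by
  refine .combine _ h.card_le (fun i => F ((Fintype.equivFin ι).symm i)) _ (fun i => hF _)
    ⟨fun _ => 0, ?_⟩
  have := h.formsStable
  simp only [translateBy_zero]
  exact this

theorem Joins.grows {ι : Type*} [Fintype ι] {F : ι → Assembly} (h : Joins F)
    (hF : ∀ i, Producible sierpinskiSystem (F i)) (i : ι) :
    GrowsInOneStep sierpinskiSystem (F i) (Finset.univ.biUnion F) :=
  ⟨_, h.card_le, fun i => F ((Fintype.equivFin ι).symm i), fun _ => hF _,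
    ⟨Fintype.equivFin ι i, by simp⟩, h.formsStable⟩

theorem Producible.pt (k : Role) (q : ℤ × ℤ) : Producible sierpinskiSystem {pt k q} :=
  .base _ (Finset.mem_image_of_mem _ (Finset.mem_univ k)) _

/-- A nonempty stable part of a set of at most six tiles of a motif grows by single tiles. -/
theorem grows_place {U : Assembly} {M : Finset Role} {q : ℤ × ℤ} {m : Motif}
    (hU : Producible sierpinskiSystem U) (hUM : U ⊆ place M q) (hM : ∀ k ∈ M, k.motif = m)
    (hcard : M.card ≤ 6) (hst : Stable sierpinskiStr 2 (place M q)) :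
    GrowsInOneStep sierpinskiSystem U (place M q) ∧ Producible sierpinskiSystem (place M q) := by
  classical
  set N : Finset Role := M.filter fun k => _root_.pt k q ∉ U with hN
  have hUN : U = place (M \ N) q := by
    ext x
    simp only [mem_place, Finset.mem_sdiff, hN, Finset.mem_filter, not_and, not_not]
    constructor
    · intro hx
      obtain ⟨k, hk, rfl⟩ := mem_place.1 (hUM hx)
      exact ⟨k, ⟨hk, fun _ => hx⟩, rfl⟩
    · rintro ⟨k, ⟨hk, h⟩, rfl⟩
      exact h hk
  let F : Option N → Assembly := fun o => o.elim U fun k => {_root_.pt k q}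
  have hF : ∀ i, Producible sierpinskiSystem (F i) := by
    rintro (_ | k)
    · exact hU
    · exact Producible.pt _ _
  have hunion : Finset.univ.biUnion F = place M q := by
    ext x
    simp only [Finset.mem_biUnion, Finset.mem_univ, true_and, Option.exists, F, Option.elim,
      Finset.mem_singleton]
    constructor
    · rintro (h | ⟨k, rfl⟩)
      · exact hUM h
      · exact pt_mem_place.2 ⟨(Finset.mem_filter.1 k.2).1, rfl⟩
    · intro hx
      obtain ⟨k, hk, rfl⟩ := mem_place.1 hx
      by_cases hkU : _root_.pt k q ∈ U
      · exact .inl hkU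
      · exact .inr ⟨⟨k, Finset.mem_filter.2 ⟨hk, hkU⟩⟩, rfl⟩
  have hsing : ∀ k, ({_root_.pt k q} : Assembly) = place {k} q := fun k => by simp [place]
  have hUk : ∀ k : N, Disjoint (shape U) (shape {_root_.pt k.1 q}) := by
    intro k
    rw [hUN, hsing]
    refine disjoint_shape_place q (m := m) (fun i hi => hM i (Finset.mem_sdiff.1 hi).1) ?_ ?_
    · simpa using hM _ (Finset.mem_filter.1 k.2).1
    · exact Finset.disjoint_singleton_right.2 fun h => (Finset.mem_sdiff.1 h).2 k.2
  have hJ : Joins F := by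
    refine ⟨?_, ?_, hunion ▸ hst⟩
    · rw [Fintype.card_option, Fintype.card_coe]
      -- `U` takes one hand and contains at least one tile of `M`, so `U` and the missing single
      -- tiles need at most `M.card` hands.
      have : (M \ N).Nonempty := by
        have := hU.stable.2.1
        rw [hUN] at this
        exact Finset.image_nonempty.1 this
      have h1 := Finset.card_pos.2 this
      rw [Finset.card_sdiff_of_subset (show N ⊆ M from Finset.filter_subset _ _)] at h1
      omega
    · rintro (_ | k) (_ | k') h
      · exact absurd rfl h
      · exact hUk k'
      · exact (hUk k).symm
      · exact disjoint_shape_singleton q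
          ((hM _ (Finset.mem_filter.1 k.2).1).trans (hM _ (Finset.mem_filter.1 k'.2).1).symm)
          fun h' => h (congrArg some (Subtype.ext h'))
  have h1 := hJ.grows hF none
  have h2 := hJ.producible hF
  rw [hunion] at h1 h2
  exact ⟨h1, h2⟩

theorem producible_place {M : Finset Role} {q : ℤ × ℤ} {m : Motif} {k : Role} (hk : k ∈ M)
    (hM : ∀ k ∈ M, k.motif = m) (hcard : M.card ≤ 6) (hst : Stable sierpinskiStr 2 (place M q)) :
    Producible sierpinskiSystem (place M q) :=
  (grows_place (Producible.pt k q) (by simpa using pt_mem_place.2 ⟨hk, rfl⟩) hM hcard hst).2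

theorem joins_pair {A B : Assembly} (hd : Disjoint (shape A) (shape B))
    (hst : Stable sierpinskiStr 2 (A ∪ B)) : Joins fun i : Bool => if i then A else B := by
  refine ⟨by simp, ?_, ?_⟩
  · rintro (_ | _) (_ | _) h <;> simp_all [hd.symm]
  · convert hst using 1
    ext x
    simp

theorem biUnion_bool (A B : Assembly) :
    (Finset.univ.biUnion fun i : Bool => if i then A else B) = A ∪ B := by
  ext x
  simp

theorem producible_apex_halves (q : ℤ × ℤ) :
    Producible sierpinskiSystem (place {a0, a1, a2, a3} q) ∧
      Producible sierpinskiSystem (place {a4, a5, a6, a7} q) :=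
  ⟨producible_place (k := a0) (m := .apex) (by decide) (by decide) (by decide)
    (stable_apex_left q),
   producible_place (k := a4) (m := .apex) (by decide) (by decide) (by decide)
    (stable_apex_right q)⟩

/-- The eight tiles of an apex exceed the six hands, so an apex arises from its two halves instead
of from single tiles. -/
theorem grows_apex_halves (q : ℤ × ℤ) :
    GrowsInOneStep sierpinskiSystem (place {a0, a1, a2, a3} q) (inst .apex q) ∧
      GrowsInOneStep sierpinskiSystem (place {a4, a5, a6, a7} q) (inst .apex q) ∧
      Producible sierpinskiSystem (inst .apex q) := by
  have hJ := joins_pair (disjoint_apex_halves q) (inst_apex q ▸ stable_inst .apex q)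
  have hF : ∀ i : Bool, Producible sierpinskiSystem
      (if i then place {a0, a1, a2, a3} q else place {a4, a5, a6, a7} q) := by
    rintro (_ | _)
    · exact (producible_apex_halves q).2
    · exact (producible_apex_halves q).1
  have h1 := hJ.grows hF true
  have h2 := hJ.grows hF false
  have h3 := hJ.producible hF
  rw [biUnion_bool, ← inst_apex] at h1 h2 h3
  exact ⟨h1, h2, h3⟩

theorem producible_inst (m : Motif) (q : ℤ × ℤ) : Producible sierpinskiSystem (inst m q) := by
  by_cases hm : m = .apex
  · subst hm
    exact (grows_apex_halves q).2.2
  · have hst := stable_inst m q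
    obtain ⟨x, hx⟩ := hst.2.1
    obtain ⟨k, hk, -⟩ := mem_place.1 hx
    exact producible_place (m := m) hk (by simp) (by revert hm; cases m <;> decide) hst

/-! ### The stages -/

/-- The six assemblies that are combined to the next stage, in cyclic order: the lower stage `Y`,
the right link, the upper right stage `Z`, the top link `m`, the upper left stage `X` and the left
link. -/
def pieces (n : ℕ) (p : ℤ × ℤ) (m : Motif) (X Y Z : Assembly) : Fin 6 → Assembly :=
  ![Y, inst .right (p + (2 ^ n - 1, 2 * 2 ^ n - 2)), Z, inst m (p + (-1, 4 * 2 ^ n - 2)), X,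
    inst .left (p + (-2 ^ n, 2 * 2 ^ n - 2))]

/-- `A` is an assembly of the stage `n` of the fractal with origin `p` without the leftmost and the
rightmost points, and without the bottommost points unless `b` holds. -/
inductive IsStage : ℕ → Bool → ℤ × ℤ → Assembly → Prop
  | core (p : ℤ × ℤ) : IsStage 1 false p (inst .core p)
  | apex (p : ℤ × ℤ) : IsStage 1 true p (inst .apex p)
  | step {n : ℕ} {b : Bool} {p : ℤ × ℤ} {m : Motif} {X Y Z : Assembly} (hm : m = .top ∨ m = .top')
      (hY : IsStage n b p Y) (hX : IsStage n false (p + (-2 ^ n, 2 * 2 ^ n)) X)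
      (hZ : IsStage n false (p + (2 ^ n, 2 * 2 ^ n)) Z) :
      IsStage (n + 1) b p (Finset.univ.biUnion (pieces n p m X Y Z))

theorem mem_biUnion_pieces {n : ℕ} {p : ℤ × ℤ} {m : Motif} {X Y Z : Assembly} {x : PlacedTile} :
    x ∈ Finset.univ.biUnion (pieces n p m X Y Z) ↔
      x ∈ Y ∨ x ∈ X ∨ x ∈ Z ∨ x ∈ inst .left (p + (-2 ^ n, 2 * 2 ^ n - 2)) ∨
      x ∈ inst .right (p + (2 ^ n - 1, 2 * 2 ^ n - 2)) ∨ x ∈ inst m (p + (-1, 4 * 2 ^ n - 2)) := by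
  simp only [Finset.mem_biUnion, Finset.mem_univ, true_and, Fin.exists_fin_succ, pieces]
  simp
  tauto

theorem mem_shape_pieces {n : ℕ} {p : ℤ × ℤ} {m : Motif} {X Y Z : Assembly} {c : ℤ × ℤ} :
    c ∈ shape (Finset.univ.biUnion (pieces n p m X Y Z)) ↔
      c ∈ shape Y ∨ c ∈ shape X ∨ c ∈ shape Z ∨
      c ∈ shape (inst .left (p + (-2 ^ n, 2 * 2 ^ n - 2))) ∨
      c ∈ shape (inst .right (p + (2 ^ n - 1, 2 * 2 ^ n - 2))) ∨
      c ∈ shape (inst m (p + (-1, 4 * 2 ^ n - 2))) := by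
  simp only [shape, Set.mem_ofPred_eq, mem_biUnion_pieces, or_and_right, exists_or]

theorem mem_shape_inst {m : Motif} {q c : ℤ × ℤ} :
    c ∈ shape (inst m q) ↔ ∃ k : Role, k.motif = m ∧ q + k.off = c := by
  constructor
  · rintro ⟨x, hx, rfl⟩
    obtain ⟨k, hk, rfl⟩ := mem_inst.1 hx
    exact ⟨k, hk, rfl⟩
  · rintro ⟨k, hk, rfl⟩
    exact ⟨pt k q, mem_inst.2 ⟨k, hk, rfl⟩, rfl⟩

theorem exists_role (P : Role → Prop) : (∃ k, P k) ↔
    P c0 ∨ P c1 ∨ P c2 ∨ P c3 ∨ P c4 ∨ P c5 ∨ P a0 ∨ P a1 ∨ P a2 ∨ P a3 ∨ P a4 ∨ P a5 ∨ P a6 ∨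
    P a7 ∨ P l0 ∨ P l1 ∨ P l2 ∨ P l3 ∨ P r0 ∨ P r1 ∨ P r2 ∨ P r3 ∨ P s0 ∨ P s1 ∨ P s2 ∨ P s3 ∨
    P t0 ∨ P t1 ∨ P t2 ∨ P t3 := by
  constructor
  · rintro ⟨k, hk⟩
    cases k <;> simp only [hk, true_or, or_true]
  · intro h
    rcases h with h | h | h | h | h | h | h | h | h | h | h | h | h | h | h | h | h | h | h | h |
      h | h | h | h | h | h | h | h | h | h <;> exact ⟨_, h⟩

theorem mem_shape_left {q c : ℤ × ℤ} : c ∈ shape (inst .left q) ↔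
    (c.1 = q.1 ∧ q.2 ≤ c.2 ∧ c.2 ≤ q.2 + 2) ∨ (c.1 = q.1 - 1 ∧ c.2 = q.2 + 2) := by
  obtain ⟨c1, c2⟩ := c
  simp only [mem_shape_inst, exists_role, motif, off, Prod.ext_iff, Prod.fst_add, Prod.snd_add,
    reduceCtorEq, false_and, true_and, false_or, or_false]
  omega

theorem mem_shape_right {q c : ℤ × ℤ} : c ∈ shape (inst .right q) ↔
    (c.1 = q.1 ∧ q.2 ≤ c.2 ∧ c.2 ≤ q.2 + 2) ∨ (c.1 = q.1 + 1 ∧ c.2 = q.2 + 2) := by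
  obtain ⟨c1, c2⟩ := c
  simp only [mem_shape_inst, exists_role, motif, off, Prod.ext_iff, Prod.fst_add, Prod.snd_add,
    reduceCtorEq, false_and, true_and, false_or, or_false]
  omega

theorem mem_shape_top {m : Motif} (hm : m = .top ∨ m = .top') {q c : ℤ × ℤ} :
    c ∈ shape (inst m q) ↔ (q.1 ≤ c.1 ∧ c.1 ≤ q.1 + 1) ∧ (q.2 ≤ c.2 ∧ c.2 ≤ q.2 + 1) := by
  obtain ⟨c1, c2⟩ := c
  rcases hm with rfl | rfl <;>
  · simp only [mem_shape_inst, exists_role, motif, off, Prod.ext_iff, Prod.fst_add, Prod.snd_add,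
      reduceCtorEq, false_and, true_and, false_or, or_false]
    omega

theorem mem_shape_core {q c : ℤ × ℤ} : c ∈ shape (inst .core q) ↔
    (q.1 - 1 ≤ c.1 ∧ c.1 ≤ q.1) ∧ (q.2 + 1 ≤ c.2 ∧ c.2 ≤ q.2 + 3) := by
  obtain ⟨c1, c2⟩ := c
  simp only [mem_shape_inst, exists_role, motif, off, Prod.ext_iff, Prod.fst_add, Prod.snd_add,
    reduceCtorEq, false_and, true_and, or_false]
  omega

theorem mem_shape_apex {q c : ℤ × ℤ} : c ∈ shape (inst .apex q) ↔
    (q.1 - 1 ≤ c.1 ∧ c.1 ≤ q.1) ∧ (q.2 ≤ c.2 ∧ c.2 ≤ q.2 + 3) := by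
  obtain ⟨c1, c2⟩ := c
  simp only [mem_shape_inst, exists_role, motif, off, Prod.ext_iff, Prod.fst_add, Prod.snd_add,
    reduceCtorEq, false_and, true_and, false_or, or_false]
  omega

theorem IsStage.one_le {n : ℕ} {b : Bool} {p : ℤ × ℤ} {A : Assembly} (h : IsStage n b p A) :
    1 ≤ n := by
  cases h <;> omega

theorem IsStage.two_le_pow {n : ℕ} {b : Bool} {p : ℤ × ℤ} {A : Assembly} (h : IsStage n b p A) :
    (2 : ℤ) ≤ 2 ^ n :=
  le_self_pow₀ (by norm_num) (by have := h.one_le; omega)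

/-- A convex region that contains the stage. -/
theorem IsStage.bounds {n : ℕ} {b : Bool} {p : ℤ × ℤ} {A : Assembly} (h : IsStage n b p A)
    {c : ℤ × ℤ} (hc : c ∈ shape A) :
    p.2 ≤ c.2 ∧ c.2 < p.2 + 2 * 2 ^ n ∧ 2 * (c.1 - p.1) ≤ c.2 - p.2 ∧
      -2 * (c.1 - p.1) - 2 ≤ c.2 - p.2 ∧ p.1 - 2 ^ n + 1 ≤ c.1 ∧ c.1 ≤ p.1 + 2 ^ n - 2 ∧
      (b = false → p.2 + 1 ≤ c.2) := by
  induction h with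
  | core p =>
    rw [mem_shape_core] at hc
    norm_num
    omega
  | apex p =>
    rw [mem_shape_apex] at hc
    norm_num
    omega
  | @step n b p m X Y Z hm hY hX hZ ihY ihX ihZ =>
    have hN := hY.two_le_pow
    rw [pow_succ]
    simp only [mem_shape_pieces, mem_shape_left, mem_shape_right, mem_shape_top hm, Prod.fst_add,
      Prod.snd_add] at hc ihX ihZ
    generalize (2 : ℤ) ^ n = N at *
    rcases hc with hc | hc | hc | hc | hc | hc
    · obtain ⟨h1, h2, h3, h4, h5, h6, h7⟩ := ihY hc
      exact ⟨by omega, by omega, by omega, by omega, by omega, by omega, h7⟩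
    · have := ihX hc
      simp only [forall_const] at this
      omega
    · have := ihZ hc
      simp only [forall_const] at this
      omega
    all_goals omega

/-- The origins of the cores at the upper corners of a stage. -/
def leftOrigin (n : ℕ) (p : ℤ × ℤ) : ℤ × ℤ := p + (-2 ^ n + 2, 2 * 2 ^ n - 4)
def rightOrigin (n : ℕ) (p : ℤ × ℤ) : ℤ × ℤ := p + (2 ^ n - 2, 2 * 2 ^ n - 4)

/-- The tile `k` with motif origin `q` has an exposed outer glue on the stage. -/
def Exposed (n : ℕ) (b : Bool) (p : ℤ × ℤ) (k : Role) (q : ℤ × ℤ) : Prop :=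
  ((k = c0 ∨ k = a0) ∧ q = leftOrigin n p) ∨ ((k = c3 ∨ k = a4) ∧ q = rightOrigin n p) ∨
    ((k = c4 ∨ k = c5) ∧ b = false ∧ q = p)

theorem leftOrigin_succ (n : ℕ) (p : ℤ × ℤ) :
    leftOrigin n (p + (-2 ^ n, 2 * 2 ^ n)) = leftOrigin (n + 1) p := by
  simp only [leftOrigin, Prod.ext_iff, Prod.fst_add, Prod.snd_add, pow_succ]
  constructor <;> ring

theorem rightOrigin_succ (n : ℕ) (p : ℤ × ℤ) :
    rightOrigin n (p + (2 ^ n, 2 * 2 ^ n)) = rightOrigin (n + 1) p := by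
  simp only [rightOrigin, Prod.ext_iff, Prod.fst_add, Prod.snd_add, pow_succ]
  constructor <;> ring

/-- The upper corners of a stage are inherited from `X` and `Z`, and its bottom from `Y`. These are
the tiles to which links attach. -/
theorem IsStage.port_mem {n : ℕ} {b : Bool} {p : ℤ × ℤ} {A : Assembly} (h : IsStage n b p A) :
    (∃ k, (k = c0 ∨ k = a0) ∧ pt k (leftOrigin n p) ∈ A) ∧
    (∃ k, (k = c3 ∨ k = a4) ∧ pt k (rightOrigin n p) ∈ A) ∧
    (b = false → pt c4 p ∈ A ∧ pt c5 p ∈ A) := by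
  induction h with
  | core p =>
    have h1 : leftOrigin 1 p = p := by simp [leftOrigin]
    have h2 : rightOrigin 1 p = p := by simp [rightOrigin]
    rw [h1, h2]
    exact ⟨⟨c0, .inl rfl, pt_mem_inst.2 ⟨rfl, rfl⟩⟩, ⟨c3, .inl rfl, pt_mem_inst.2 ⟨rfl, rfl⟩⟩,
      fun _ => ⟨pt_mem_inst.2 ⟨rfl, rfl⟩, pt_mem_inst.2 ⟨rfl, rfl⟩⟩⟩
  | apex p =>
    have h1 : leftOrigin 1 p = p := by simp [leftOrigin]
    have h2 : rightOrigin 1 p = p := by simp [rightOrigin]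
    rw [h1, h2]
    exact ⟨⟨a0, .inr rfl, pt_mem_inst.2 ⟨rfl, rfl⟩⟩, ⟨a4, .inr rfl, pt_mem_inst.2 ⟨rfl, rfl⟩⟩,
      fun h => by cases h⟩
  | @step n b p m X Y Z hm hY hX hZ ihY ihX ihZ =>
    rw [leftOrigin_succ] at ihX
    rw [rightOrigin_succ] at ihZ
    simp only [mem_biUnion_pieces]
    obtain ⟨k, hk, hkX⟩ := ihX.1
    obtain ⟨k', hk', hkZ⟩ := ihZ.2.1
    exact ⟨⟨k, hk, .inr (.inl hkX)⟩, ⟨k', hk', .inr (.inr (.inl hkZ))⟩,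
      fun hb => ⟨.inl (ihY.2.2 hb).1, .inl (ihY.2.2 hb).2⟩⟩

/-- Stages consist of complete motifs. This leaves no room for another piece with a tile of one of
these motifs. -/
theorem IsStage.motif_mem {n : ℕ} {b : Bool} {p : ℤ × ℤ} {A : Assembly} (h : IsStage n b p A)
    {k : Role} {q : ℤ × ℤ} (hk : pt k q ∈ A) : inst k.motif q ⊆ A := by
  have key : ∀ m p, pt k q ∈ inst m p → inst k.motif q = inst m p := by
    intro m p h
    obtain ⟨h1, h2⟩ := pt_mem_inst.1 h
    rw [h1, h2]
  induction h with
  | core p => exact (key _ _ hk).subset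
  | apex p => exact (key _ _ hk).subset
  | @step n b p m X Y Z hm hY hX hZ ihY ihX ihZ =>
    intro x hx
    rw [mem_biUnion_pieces] at hk ⊢
    rcases hk with hk | hk | hk | hk | hk | hk
    · exact .inl (ihY hk hx)
    · exact .inr (.inl (ihX hk hx))
    · exact .inr (.inr (.inl (ihZ hk hx)))
    · exact .inr (.inr (.inr (.inl (key _ _ hk ▸ hx))))
    · exact .inr (.inr (.inr (.inr (.inl (key _ _ hk ▸ hx)))))
    · exact .inr (.inr (.inr (.inr (.inr (key _ _ hk ▸ hx)))))

theorem IsStage.exists_pt {n : ℕ} {b : Bool} {p : ℤ × ℤ} {A : Assembly} (h : IsStage n b p A)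
    {x : PlacedTile} (hx : x ∈ A) : ∃ k q, pt k q = x := by
  have key : ∀ m p, x ∈ inst m p → ∃ k q, pt k q = x := fun m p h =>
    let ⟨k, _, hk⟩ := mem_inst.1 h
    ⟨k, p, hk⟩
  induction h with
  | core p => exact key _ _ hx
  | apex p => exact key _ _ hx
  | step hm hY hX hZ ihY ihX ihZ =>
    rw [mem_biUnion_pieces] at hx
    rcases hx with hk | hk | hk | hk | hk | hk
    · exact ihY hk
    · exact ihX hk
    · exact ihZ hk
    all_goals exact key _ _ hk

/-- Every outer glue on a stage is exposed at a corner or faces another tile of the stage. -/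
theorem IsStage.port_cases {n : ℕ} {b : Bool} {p : ℤ × ℤ} {A : Assembly} (h : IsStage n b p A)
    {k : Role} {q : ℤ × ℤ} (hk : pt k q ∈ A) :
    q + k.off + k.port ∈ shape A ∨ Exposed n b p k q := by
  induction h with
  | core p =>
    obtain ⟨h1, rfl⟩ := pt_mem_inst.1 hk
    have h2 : leftOrigin 1 q = q := by simp [leftOrigin]
    have h3 : rightOrigin 1 q = q := by simp [rightOrigin]
    rw [mem_shape_core]
    cases k <;> simp [motif, port, off, Exposed, h2, h3] at h1 ⊢
  | apex p =>
    obtain ⟨h1, rfl⟩ := pt_mem_inst.1 hk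
    have h2 : leftOrigin 1 q = q := by simp [leftOrigin]
    have h3 : rightOrigin 1 q = q := by simp [rightOrigin]
    rw [mem_shape_apex]
    cases k <;> simp [motif, port, off, Exposed, h2, h3] at h1 ⊢
  | @step n b p m X Y Z hm hY hX hZ ihY ihX ihZ =>
    have hcell : ∀ {B : Assembly} {c : ℤ × ℤ} {k r}, pt k r ∈ B → r + k.off = c → c ∈ shape B :=
      fun h h' => h' ▸ mem_shape_of_mem h
    obtain ⟨⟨kY, hkY, hYl⟩, ⟨kY', hkY', hYr⟩, -⟩ := hY.port_mem
    obtain ⟨-, ⟨kX, hkX, hXr⟩, hXd⟩ := hX.port_mem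
    obtain ⟨⟨kZ, hkZ, hZl⟩, -, hZd⟩ := hZ.port_mem
    rw [mem_biUnion_pieces] at hk
    rw [mem_shape_pieces, mem_shape_left, mem_shape_right, mem_shape_top hm]
    rcases hk with hk | hk | hk | hk | hk | hk
    -- Of the exposed glues of the three smaller stages, the left one of `X`, the right one of `Z`
    -- and the bottom of `Y` stay exposed. All others now face a link.
    · rcases ihY hk with h | ⟨hk', rfl⟩ | ⟨hk', rfl⟩ | ⟨hk', rfl, rfl⟩
      · exact .inl (.inl h)
      · left; right; right; right; left
        rcases hk' with rfl | rfl <;> simp [leftOrigin, off, port] <;> omega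
      · left; right; right; right; right; left
        rcases hk' with rfl | rfl <;> simp [rightOrigin, off, port] <;> omega
      · exact .inr (.inr (.inr ⟨hk', rfl, rfl⟩))
    · rcases ihX hk with h | ⟨hk', rfl⟩ | ⟨hk', rfl⟩ | ⟨hk', -, rfl⟩
      · exact .inl (.inr (.inl h))
      · exact .inr (.inl ⟨hk', leftOrigin_succ n p⟩)
      · left; right; right; right; right; right
        rcases hk' with rfl | rfl <;> simp [rightOrigin, off, port] <;> omega
      · left; right; right; right; left
        rcases hk' with rfl | rfl <;> simp [off, port] <;> omega
    · rcases ihZ hk with h | ⟨hk', rfl⟩ | ⟨hk', rfl⟩ | ⟨hk', -, rfl⟩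
      · exact .inl (.inr (.inr (.inl h)))
      · left; right; right; right; right; right
        rcases hk' with rfl | rfl <;> simp [leftOrigin, off, port] <;> omega
      · exact .inr (.inr (.inl ⟨hk', rightOrigin_succ n p⟩))
      · left; right; right; right; right; left
        rcases hk' with rfl | rfl <;> simp [off, port] <;> omega
    · left
      obtain ⟨h1, rfl⟩ := pt_mem_inst.1 hk
      cases k <;> simp only [motif, reduceCtorEq] at h1
      · left
        refine hcell hYl ?_
        rcases hkY with rfl | rfl <;>
          simp only [leftOrigin, off, port, Prod.ext_iff, Prod.fst_add, Prod.snd_add] <;> omega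
      · right; right; right; left; simp [off, port]
      · right; right; right; left; simp [off, port]
      · right; left
        refine hcell (hXd rfl).2 ?_
        simp only [off, port, Prod.ext_iff, Prod.fst_add, Prod.snd_add]
        omega
    · left
      obtain ⟨h1, rfl⟩ := pt_mem_inst.1 hk
      cases k <;> simp only [motif, reduceCtorEq] at h1
      · left
        refine hcell hYr ?_
        rcases hkY' with rfl | rfl <;>
          simp only [rightOrigin, off, port, Prod.ext_iff, Prod.fst_add, Prod.snd_add] <;> omega
      · right; right; right; right; left; simp [off, port]
      · right; right; right; right; left; simp [off, port]
      · right; right; left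
        refine hcell (hZd rfl).1 ?_
        simp only [off, port, Prod.ext_iff, Prod.fst_add, Prod.snd_add]
        omega
    · left
      obtain ⟨h1, rfl⟩ := pt_mem_inst.1 hk
      have hX' : ∀ k : Role, k.off = (0, 0) → k.port = (-1, 0) →
          p + (-1, 4 * 2 ^ n - 2) + k.off + k.port ∈ shape X := by
        intro k h0 h0'
        rw [h0, h0']
        refine hcell hXr ?_
        rcases hkX with rfl | rfl <;>
          simp only [rightOrigin, off, Prod.ext_iff, Prod.fst_add, Prod.snd_add] <;> omega
      have hZ' : ∀ k : Role, k.off = (1, 0) → k.port = (1, 0) →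
          p + (-1, 4 * 2 ^ n - 2) + k.off + k.port ∈ shape Z := by
        intro k h0 h0'
        rw [h0, h0']
        refine hcell hZl ?_
        rcases hkZ with rfl | rfl <;>
          simp only [leftOrigin, off, Prod.ext_iff, Prod.fst_add, Prod.snd_add] <;> omega
      rcases hm with rfl | rfl <;> cases k <;> simp only [motif, reduceCtorEq] at h1
      all_goals first
        | exact .inr (.inl (hX' _ rfl rfl))
        | exact .inr (.inr (.inl (hZ' _ rfl rfl)))
        | (right; right; right; right; right; simp [off, port])

theorem one_le_bond_of_mates {k k' : Role} {q q' : ℤ × ℤ} (h : Mates k k')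
    (hq : q' + k'.off = q + k.off + k.port) : 1 ≤ bond sierpinskiStr (pt k q) (pt k' q') := by
  have key : ∀ k k' : Role, Mates k k' →
      1 ≤ bond sierpinskiStr (pt k 0) (pt k' (k.off + k.port - k'.off)) := by decide
  have hq' : q' = k.off + k.port - k'.off + q := by
    rw [eq_sub_of_add_eq hq]
    abel
  have := key k k' h
  rw [← bond_translate _ q] at this
  convert this using 2
  · simp [pt, add_comm]
  · simp only [pt, hq', Prod.mk.injEq, and_true]
    abel

theorem pieces_disjoint {n : ℕ} {b : Bool} {p : ℤ × ℤ} {m : Motif} {X Y Z : Assembly}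
    (hm : m = .top ∨ m = .top') (hY : IsStage n b p Y)
    (hX : IsStage n false (p + (-2 ^ n, 2 * 2 ^ n)) X)
    (hZ : IsStage n false (p + (2 ^ n, 2 * 2 ^ n)) Z) (i j : Fin 6) (hij : i ≠ j) :
    Disjoint (shape (pieces n p m X Y Z i)) (shape (pieces n p m X Y Z j)) := by
  wlog hlt : i < j generalizing i j
  · exact (this j i hij.symm (lt_of_le_of_ne (not_lt.1 hlt) hij.symm)).symm
  rw [Set.disjoint_left]
  intro c hi hj
  have hN := hY.two_le_pow
  have bY := hY.bounds (c := c)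
  have bX := hX.bounds (c := c)
  have bZ := hZ.bounds (c := c)
  have bL := (mem_shape_left (q := p + (-2 ^ n, 2 * 2 ^ n - 2)) (c := c)).1
  have bR := (mem_shape_right (q := p + (2 ^ n - 1, 2 * 2 ^ n - 2)) (c := c)).1
  have bT := (mem_shape_top hm (q := p + (-1, 4 * 2 ^ n - 2)) (c := c)).1
  simp only [Prod.fst_add, Prod.snd_add, forall_const] at bY bX bZ bL bR bT
  fin_cases i <;> fin_cases j <;> first | (exfalso; revert hlt; decide) | skip
  all_goals
    simp only [pieces, Fin.mk_zero, Fin.reduceFinMk, Fin.mk_one, Matrix.cons_val] at hi hj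
    -- The fifteen cases are linear in `N`, and `2 ≤ N` is all that is needed about the power.
    generalize (2 : ℤ) ^ n = N at *
  · have := bY hi; have := bR hj; omega
  · have := bY hi; have := bZ hj; omega
  · have := bY hi; have := bT hj; omega
  · have := bY hi; have := bX hj; omega
  · have := bY hi; have := bL hj; omega
  · have := bR hi; have := bZ hj; omega
  · have := bR hi; have := bT hj; omega
  · have := bR hi; have := bX hj; omega
  · have := bR hi; have := bL hj; omega
  · have := bZ hi; have := bT hj; omega
  · have := bZ hi; have := bX hj; omega
  · have := bZ hi; have := bL hj; omega
  · have := bT hi; have := bX hj; omega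
  · have := bT hi; have := bL hj; omega
  · have := bX hi; have := bL hj; omega

theorem one_le_sum_of_mates {A B : Assembly} {k k' : Role} {q q' : ℤ × ℤ} (h : Mates k k')
    (hA : pt k q ∈ A) (hB : pt k' q' ∈ B) (hq : q' + k'.off = q + k.off + k.port) :
    1 ≤ ∑ x ∈ A, ∑ y ∈ B, bond sierpinskiStr x y :=
  (one_le_bond_of_mates h hq).trans (le_sum_bond hA hB)

theorem one_le_sum_of_mates' {A B : Assembly} {k k' : Role} {q q' : ℤ × ℤ} (h : Mates k k')
    (hA : pt k q ∈ A) (hB : pt k' q' ∈ B) (hq : q' + k'.off = q + k.off + k.port) :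
    1 ≤ ∑ y ∈ B, ∑ x ∈ A, bond sierpinskiStr y x := by
  rw [Finset.sum_comm]
  simpa only [bond_comm] using one_le_sum_of_mates h hA hB hq

/-- Consecutive pieces in the cyclic order share one weak bond. Each bond goes from a corner or
bottom tile of `port_mem` to an end of a link. -/
theorem pieces_stable {n : ℕ} {b : Bool} {p : ℤ × ℤ} {m : Motif} {X Y Z : Assembly}
    (hm : m = .top ∨ m = .top') (hY : IsStage n b p Y)
    (hX : IsStage n false (p + (-2 ^ n, 2 * 2 ^ n)) X)
    (hZ : IsStage n false (p + (2 ^ n, 2 * 2 ^ n)) Z) (sX : Stable sierpinskiStr 2 X)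
    (sY : Stable sierpinskiStr 2 Y) (sZ : Stable sierpinskiStr 2 Z) :
    Stable sierpinskiStr 2 (Finset.univ.biUnion (pieces n p m X Y Z)) := by
  refine stable_cycle _ ?_ (pieces_disjoint hm hY hX hZ) ?_
  · intro i
    fin_cases i
    exacts [sY, stable_inst _ _, sZ, stable_inst _ _, sX, stable_inst _ _]
  · obtain ⟨⟨kY, hkY, hYl⟩, ⟨kY', hkY', hYr⟩, -⟩ := hY.port_mem
    obtain ⟨-, ⟨kX, hkX, hXr⟩, hXd⟩ := hX.port_mem
    obtain ⟨⟨kZ, hkZ, hZl⟩, -, hZd⟩ := hZ.port_mem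
    intro i
    fin_cases i
    · refine one_le_sum_of_mates (k' := r0) (by rcases hkY' with rfl | rfl <;> decide) hYr
        (pt_mem_inst.2 ⟨rfl, rfl⟩) ?_
      rcases hkY' with rfl | rfl <;>
        simp only [rightOrigin, off, port, Prod.ext_iff, Prod.fst_add, Prod.snd_add] <;> omega
    · refine one_le_sum_of_mates' (k' := r3) (by decide) (hZd rfl).1 (pt_mem_inst.2 ⟨rfl, rfl⟩) ?_
      simp only [off, port, Prod.ext_iff, Prod.fst_add, Prod.snd_add]
      omega
    · rcases hm with rfl | rfl
      · refine one_le_sum_of_mates (k' := s3) (by rcases hkZ with rfl | rfl <;> decide) hZl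
          (pt_mem_inst.2 ⟨rfl, rfl⟩) ?_
        rcases hkZ with rfl | rfl <;>
          simp only [leftOrigin, off, port, Prod.ext_iff, Prod.fst_add, Prod.snd_add] <;> omega
      · refine one_le_sum_of_mates (k' := t3) (by rcases hkZ with rfl | rfl <;> decide) hZl
          (pt_mem_inst.2 ⟨rfl, rfl⟩) ?_
        rcases hkZ with rfl | rfl <;>
          simp only [leftOrigin, off, port, Prod.ext_iff, Prod.fst_add, Prod.snd_add] <;> omega
    · rcases hm with rfl | rfl
      · refine one_le_sum_of_mates' (k' := s0) (by rcases hkX with rfl | rfl <;> decide) hXr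
          (pt_mem_inst.2 ⟨rfl, rfl⟩) ?_
        rcases hkX with rfl | rfl <;>
          simp only [rightOrigin, off, port, Prod.ext_iff, Prod.fst_add, Prod.snd_add] <;> omega
      · refine one_le_sum_of_mates' (k' := t0) (by rcases hkX with rfl | rfl <;> decide) hXr
          (pt_mem_inst.2 ⟨rfl, rfl⟩) ?_
        rcases hkX with rfl | rfl <;>
          simp only [rightOrigin, off, port, Prod.ext_iff, Prod.fst_add, Prod.snd_add] <;> omega
    · refine one_le_sum_of_mates (k' := l3) (by decide) (hXd rfl).2 (pt_mem_inst.2 ⟨rfl, rfl⟩) ?_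
      simp only [off, port, Prod.ext_iff, Prod.fst_add, Prod.snd_add]
      omega
    · refine one_le_sum_of_mates' (k' := l0) (by rcases hkY with rfl | rfl <;> decide) hYl
        (pt_mem_inst.2 ⟨rfl, rfl⟩) ?_
      rcases hkY with rfl | rfl <;>
        simp only [leftOrigin, off, port, Prod.ext_iff, Prod.fst_add, Prod.snd_add] <;> omega

theorem IsStage.stable {n : ℕ} {b : Bool} {p : ℤ × ℤ} {A : Assembly} (h : IsStage n b p A) :
    Stable sierpinskiStr 2 A := by
  induction h with
  | core p => exact stable_inst _ _
  | apex p => exact stable_inst _ _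
  | step hm hY hX hZ ihY ihX ihZ => exact pieces_stable hm hY hX hZ ihX ihY ihZ

theorem joins_pieces {n : ℕ} {b : Bool} {p : ℤ × ℤ} {m : Motif} {X Y Z : Assembly}
    (hm : m = .top ∨ m = .top') (hY : IsStage n b p Y)
    (hX : IsStage n false (p + (-2 ^ n, 2 * 2 ^ n)) X)
    (hZ : IsStage n false (p + (2 ^ n, 2 * 2 ^ n)) Z) : Joins (pieces n p m X Y Z) :=
  ⟨by simp, pieces_disjoint hm hY hX hZ, pieces_stable hm hY hX hZ hX.stable hY.stable hZ.stable⟩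

theorem IsStage.producible {n : ℕ} {b : Bool} {p : ℤ × ℤ} {A : Assembly} (h : IsStage n b p A) :
    Producible sierpinskiSystem A := by
  induction h with
  | core p => exact producible_inst _ _
  | apex p => exact producible_inst _ _
  | step hm hY hX hZ ihY ihX ihZ =>
    refine (joins_pieces hm hY hX hZ).producible fun i => ?_
    fin_cases i
    exacts [ihY, producible_inst _ _, ihZ, producible_inst _ _, ihX, producible_inst _ _]

theorem grows_pieces {n : ℕ} {b : Bool} {p : ℤ × ℤ} {m : Motif} {X Y Z : Assembly}
    (hm : m = .top ∨ m = .top') (hY : IsStage n b p Y)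
    (hX : IsStage n false (p + (-2 ^ n, 2 * 2 ^ n)) X)
    (hZ : IsStage n false (p + (2 ^ n, 2 * 2 ^ n)) Z) (i : Fin 6) :
    GrowsInOneStep sierpinskiSystem (pieces n p m X Y Z i)
      (Finset.univ.biUnion (pieces n p m X Y Z)) := by
  refine (joins_pieces hm hY hX hZ).grows (fun i => ?_) i
  fin_cases i
  exacts [hY.producible, producible_inst _ _, hZ.producible, producible_inst _ _, hX.producible,
    producible_inst _ _]

theorem exists_isStage (n : ℕ) (b : Bool) (p : ℤ × ℤ) : ∃ A, IsStage (n + 1) b p A := by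
  induction n generalizing b p with
  | zero =>
    cases b
    exacts [⟨_, .core p⟩, ⟨_, .apex p⟩]
  | succ n ih =>
    obtain ⟨Y, hY⟩ := ih b p
    obtain ⟨X, hX⟩ := ih false (p + (-2 ^ (n + 1), 2 * 2 ^ (n + 1)))
    obtain ⟨Z, hZ⟩ := ih false (p + (2 ^ (n + 1), 2 * 2 ^ (n + 1)))
    exact ⟨_, .step (.inl rfl) hY hX hZ⟩

theorem IsStage.exists_isStage {n : ℕ} {b : Bool} {p : ℤ × ℤ} {A : Assembly}
    (h : IsStage n b p A) (b' : Bool) (p' : ℤ × ℤ) : ∃ B, IsStage n b' p' B := by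
  have := _root_.exists_isStage (n - 1) b' p'
  rwa [Nat.sub_add_cancel h.one_le] at this

theorem translateBy_inst (v : ℤ × ℤ) (m : Motif) (q : ℤ × ℤ) :
    translateBy v (inst m q) = inst m (q + v) := translateBy_place v _ q

theorem IsStage.translateBy {n : ℕ} {b : Bool} {p : ℤ × ℤ} {A : Assembly} (h : IsStage n b p A)
    (v : ℤ × ℤ) : IsStage n b (p + v) (translateBy v A) := by
  induction h with
  | core p => exact translateBy_inst v _ p ▸ .core _
  | apex p => exact translateBy_inst v _ p ▸ .apex _
  | @step n b p m X Y Z hm hY hX hZ ihY ihX ihZ =>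
    rw [add_right_comm] at ihX ihZ
    have := IsStage.step hm ihY ihX ihZ
    convert this using 1
    ext x
    have hi : ∀ m q, (x.1 - v, x.2) ∈ inst m q ↔ x ∈ inst m (q + v) := by
      intro m q
      rw [← mem_translateBy, translateBy_inst]
    simp only [mem_translateBy, mem_biUnion_pieces, hi, add_right_comm p v]

/-! ### Comparison with the stages of the fractal -/

/-- The points of a stage of the fractal that are not covered. -/
def Uncovered (n : ℕ) (b : Bool) (c : ℤ × ℤ) : Prop :=
  (2 * 2 ^ n - 2 ≤ c.2 ∧ c.2 ≤ 2 * 2 ^ n - 1 ∧ (c.1 = -2 ^ n ∨ c.1 = 2 ^ n - 1)) ∨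
    (b = false ∧ c.2 = 0 ∧ -1 ≤ c.1 ∧ c.1 ≤ 0)

theorem mem_sierpinskiStage_zero {c : ℤ × ℤ} :
    c ∈ sierpinskiStage 0 ↔ (-1 ≤ c.1 ∧ c.1 ≤ 0) ∧ 0 ≤ c.2 ∧ c.2 ≤ 1 := by
  obtain ⟨x, y⟩ := c
  simp only [sierpinskiStage, Set.mem_insert_iff, Set.mem_singleton_iff, Prod.mk.injEq]
  omega

theorem mem_sierpinskiStage_succ {i : ℕ} {c : ℤ × ℤ} :
    c ∈ sierpinskiStage (i + 1) ↔ c ∈ sierpinskiStage i ∨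
      c - (-2 ^ i, 2 * 2 ^ i) ∈ sierpinskiStage i ∨ c - (2 ^ i, 2 * 2 ^ i) ∈ sierpinskiStage i := by
  have h1 : (2 : ℤ) ^ i • ((1, 2) : ℤ × ℤ) = (2 ^ i, 2 * 2 ^ i) := by
    simp [mul_comm]
  have h2 : (2 : ℤ) ^ i • ((-1, 2) : ℤ × ℤ) = (-2 ^ i, 2 * 2 ^ i) := by
    simp [mul_comm]
  have h3 : ∀ v, c ∈ (fun p => p + v) '' sierpinskiStage i ↔ c - v ∈ sierpinskiStage i := by
    intro v
    constructor
    · rintro ⟨p, hp, rfl⟩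
      simpa using hp
    · exact fun h => ⟨_, h, by simp⟩
  rw [sierpinskiStage, Set.mem_union, Set.mem_union, h1, h2, h3, h3]
  tauto

/-- The uncovered points of the three smaller stages are either filled by the three links or are
uncovered points of the larger stage. -/
theorem IsStage.mem_sierpinskiStage {n : ℕ} {b : Bool} {p : ℤ × ℤ} {A : Assembly}
    (h : IsStage n b p A) (c : ℤ × ℤ) :
    c ∈ sierpinskiStage n ↔ p + c ∈ shape A ∨ Uncovered n b c := by
  induction h generalizing c with
  | core p =>
    rw [mem_sierpinskiStage_succ, mem_shape_core]
    simp only [mem_sierpinskiStage_zero, Uncovered]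
    simp
    omega
  | apex p =>
    rw [mem_sierpinskiStage_succ, mem_shape_apex]
    simp only [mem_sierpinskiStage_zero, Uncovered]
    simp
    omega
  | @step n b p m X Y Z hm hY hX hZ ihY ihX ihZ =>
    have hs : ∀ v : ℤ × ℤ, p + v + (c - v) = p + c := fun v => by abel
    rw [mem_sierpinskiStage_succ, ihY, ihX, ihZ, mem_shape_pieces, mem_shape_left,
      mem_shape_right, mem_shape_top hm, hs, hs]
    have hN := hY.two_le_pow
    simp only [Uncovered, pow_succ, Prod.fst_add, Prod.snd_add, Prod.fst_sub, Prod.snd_sub,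
      true_and]
    generalize (2 : ℤ) ^ n = N at *
    constructor
    · rintro ((h | h | h) | (h | h) | (h | h))
      · exact .inl (.inl h)
      · left; right; right; right
        omega
      · exact .inr (.inr h)
      · exact .inl (.inr (.inl h))
      · by_cases h' : c.1 = -(N * 2)
        · right; omega
        · left; right; right; right
          omega
      · exact .inl (.inr (.inr (.inl h)))
      · by_cases h' : c.1 = N * 2 - 1
        · right; omega
        · left; right; right; right
          omega
    · rintro ((h | h | h | h | h | h) | (h | h))
      · exact .inl (.inl h)
      · exact .inr (.inl (.inl h))
      · exact .inr (.inr (.inl h))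
      -- The lower two tiles of a left or right link fill a corner of the lower stage, and the upper
      -- two fill the bottom of an upper stage.
      · by_cases h' : c.2 < 2 * N
        · left; right; left; omega
        · right; left; right; omega
      · by_cases h' : c.2 < 2 * N
        · left; right; left; omega
        · right; right; right; omega
      -- The left half of the top link fills the right corner of `X`, the right half the left corner
      -- of `Z`.
      · by_cases h' : c.1 < 0
        · right; left; right; omega
        · right; right; right; omega
      · by_cases h' : c.1 < 0
        · right; left; right; omega
        · right; right; right; omega
      · exact .inl (.inr (.inr h))

theorem IsStage.not_uncovered {n : ℕ} {b : Bool} {p : ℤ × ℤ} {A : Assembly}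
    (h : IsStage n b p A) {c : ℤ × ℤ} (hc : p + c ∈ shape A) : ¬ Uncovered n b c := by
  obtain ⟨h1, h2, h3, h4, h5, h6, h7⟩ := h.bounds hc
  simp only [Prod.fst_add, Prod.snd_add] at h1 h2 h3 h4 h5 h6 h7
  rintro (h | ⟨hb, h⟩)
  · omega
  · have := h7 hb
    omega

theorem sierpinskiStage_mono : Monotone sierpinskiStage :=
  monotone_nat_of_le_succ fun _ _ h => mem_sierpinskiStage_succ.2 (.inl h)

/-! ### Growth to the infinite shape -/

/-- The assembly grows to a translate of the infinite shape `S`. -/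
def GrowsTo (Γ : HAMSystem) (S : Set (ℤ × ℤ)) (A : Assembly) : Prop :=
  ∃ f : ℕ → Assembly, f 0 = A ∧ (∀ k, GrowsInOneStep Γ (f k) (f (k + 1))) ∧
    ∃ v : ℤ × ℤ, (⋃ k, shape (f k)) = (fun p => p + v) '' S

theorem GrowsInOneStep.subset {Γ : HAMSystem} {A B : Assembly} (h : GrowsInOneStep Γ A B) :
    A ⊆ B := by
  obtain ⟨r, -, F, -, ⟨i, rfl⟩, -, rfl, -⟩ := h
  exact Finset.subset_biUnion_of_mem F (Finset.mem_univ i)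

theorem GrowsTo.of_step {Γ : HAMSystem} {S : Set (ℤ × ℤ)} {A B : Assembly}
    (h : GrowsInOneStep Γ A B) (hB : GrowsTo Γ S B) : GrowsTo Γ S A := by
  obtain ⟨f, rfl, hf, v, hv⟩ := hB
  refine ⟨fun k => k.casesOn A f, rfl, ?_, v, ?_⟩
  · rintro (_ | k)
    · exact h
    · exact hf k
  · rw [← hv]
    refine Set.Subset.antisymm (Set.iUnion_subset ?_)
      (Set.iUnion_subset fun k => Set.subset_iUnion (fun k => shape (k.casesOn A f)) (k + 1))
    rintro (_ | k)
    · exact (shape_mono h.subset).trans (Set.subset_iUnion (fun k => shape (f k)) 0)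
    · exact Set.subset_iUnion (fun k => shape (f k)) k

/-- With an apex at its bottom the stage can play the role of `Y` again and again, always with the
same origin. A point missing at one level is covered at the next. -/
theorem IsStage.growsTo_of_true {n : ℕ} {p : ℤ × ℤ} {A : Assembly} (h : IsStage n true p A) :
    GrowsTo sierpinskiSystem (⋃ i, sierpinskiStage i) A := by
  have hstep : ∀ (k : ℕ) (B : {B // IsStage k true p B}),
      ∃ C : {C // IsStage (k + 1) true p C}, GrowsInOneStep sierpinskiSystem B.1 C.1 := by
    rintro k ⟨B, hB⟩
    obtain ⟨X, hX⟩ := hB.exists_isStage false (p + (-2 ^ k, 2 * 2 ^ k))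
    obtain ⟨Z, hZ⟩ := hB.exists_isStage false (p + (2 ^ k, 2 * 2 ^ k))
    exact ⟨⟨_, .step (.inl rfl) hB hX hZ⟩, grows_pieces (.inl rfl) hB hX hZ 0⟩
  choose next hnext using hstep
  let f : ∀ k, {B // IsStage (n + k) true p B} := fun k =>
    Nat.rec ⟨A, h⟩ (fun k B => next (n + k) B) k
  refine ⟨fun k => (f k).1, rfl, fun k => hnext (n + k) (f k), p, ?_⟩
  ext c
  simp only [Set.mem_iUnion, Set.mem_image]
  constructor
  · rintro ⟨k, hk⟩
    refine ⟨c - p, ⟨n + k, ((f k).2.mem_sierpinskiStage _).2 (.inl ?_)⟩, by simp⟩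
    rwa [add_sub_cancel]
  · rintro ⟨d, ⟨i, hi⟩, rfl⟩
    have h1 := sierpinskiStage_mono (show i ≤ n + i by omega) hi
    rcases ((f i).2.mem_sierpinskiStage _).1 h1 with h2 | h2
    · exact ⟨i, add_comm p d ▸ h2⟩
    · have h3 := sierpinskiStage_mono (show i ≤ n + (i + 1) by omega) hi
      rcases ((f (i + 1)).2.mem_sierpinskiStage _).1 h3 with h4 | h4
      · exact ⟨i + 1, add_comm p d ▸ h4⟩
      · exfalso
        -- The points missing at successive levels lie in rows near `2 * N` and `4 * N`, which do
        -- not overlap as `2 ≤ N`.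
        have hN := (f i).2.two_le_pow
        simp only [Uncovered, ← add_assoc, pow_succ, Bool.true_eq_false, false_and,
          or_false] at h2 h4
        generalize (2 : ℤ) ^ (n + i) = N at *
        omega

/-- A stage without its bottom first becomes the upper left part (index `4` of `pieces`) of a stage
that stands on an apex. -/
theorem IsStage.growsTo {n : ℕ} {b : Bool} {p : ℤ × ℤ} {A : Assembly} (h : IsStage n b p A) :
    GrowsTo sierpinskiSystem (⋃ i, sierpinskiStage i) A := by
  cases b with
  | true => exact h.growsTo_of_true
  | false =>
    set p' := p - (-2 ^ n, 2 * 2 ^ n) with hp'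
    have hp : p = p' + (-2 ^ n, 2 * 2 ^ n) := by simp [hp']
    obtain ⟨Y, hY⟩ := h.exists_isStage true p'
    obtain ⟨Z, hZ⟩ := h.exists_isStage false (p' + (2 ^ n, 2 * 2 ^ n))
    rw [hp] at h
    exact .of_step (grows_pieces (.inl rfl) hY h hZ 4)
      (IsStage.step (.inl rfl) hY h hZ).growsTo_of_true

/-- Every motif is a stage or one of the links in a stage. -/
theorem inst_cases (m : Motif) (q : ℤ × ℤ) : (∃ b, IsStage 1 b q (inst m q)) ∨
    ∃ p A, IsStage 2 true p A ∧ GrowsInOneStep sierpinskiSystem (inst m q) A := by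
  have key : ∀ (m' : Motif) (i : Fin 6) (p : ℤ × ℤ), (m' = .top ∨ m' = .top') →
      (∀ X Y Z, pieces 1 p m' X Y Z i = inst m q) →
      ∃ p A, IsStage 2 true p A ∧ GrowsInOneStep sierpinskiSystem (inst m q) A := by
    intro m' i p hm' hi
    have hX := IsStage.core (p + (-2 ^ 1, 2 * 2 ^ 1))
    have hZ := IsStage.core (p + (2 ^ 1, 2 * 2 ^ 1))
    have := grows_pieces hm' (.apex p) hX hZ i
    rw [hi] at this
    exact ⟨p, _, .step hm' (.apex p) hX hZ, this⟩
  cases m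
  · exact .inl ⟨_, .core q⟩
  · exact .inl ⟨_, .apex q⟩
  · refine .inr (key .top 5 (q - (-2 ^ 1, 2 * 2 ^ 1 - 2)) (.inl rfl) fun X Y Z => ?_)
    simp only [pieces, Matrix.cons_val, sub_add_cancel]
  · refine .inr (key .top 1 (q - (2 ^ 1 - 1, 2 * 2 ^ 1 - 2)) (.inl rfl) fun X Y Z => ?_)
    simp only [pieces, Matrix.cons_val, sub_add_cancel]
  · refine .inr (key .top 3 (q - (-1, 4 * 2 ^ 1 - 2)) (.inl rfl) fun X Y Z => ?_)
    simp only [pieces, Matrix.cons_val, sub_add_cancel]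
  · refine .inr (key .top' 3 (q - (-1, 4 * 2 ^ 1 - 2)) (.inr rfl) fun X Y Z => ?_)
    simp only [pieces, Matrix.cons_val, sub_add_cancel]

theorem growsTo_inst (m : Motif) (q : ℤ × ℤ) :
    GrowsTo sierpinskiSystem (⋃ i, sierpinskiStage i) (inst m q) := by
  rcases inst_cases m q with ⟨b, h⟩ | ⟨p, A, hA, h⟩
  · exact h.growsTo
  · exact .of_step h hA.growsTo

theorem growsTo_of_subset_inst {A : Assembly} {m : Motif} {q : ℤ × ℤ}
    (hA : Producible sierpinskiSystem A) (h : A ⊆ inst m q) :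
    GrowsTo sierpinskiSystem (⋃ i, sierpinskiStage i) A := by
  by_cases hm : m = .apex
  · subst hm
    rcases hA.stable.apex_cases h with rfl | h | h
    · exact growsTo_inst _ _
    · exact .of_step (grows_place (m := .apex) hA h (by decide) (by decide)
        (stable_apex_left q)).1 (.of_step (grows_apex_halves q).1 (growsTo_inst _ _))
    · exact .of_step (grows_place (m := .apex) hA h (by decide) (by decide)
        (stable_apex_right q)).1 (.of_step (grows_apex_halves q).2.1 (growsTo_inst _ _))
  · exact .of_step (grows_place (m := m) hA h (by simp) (by revert hm; cases m <;> decide)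
      (stable_inst m q)).1 (growsTo_inst _ _)

/-! ### The missing points -/

theorem finite_sierpinskiStage (i : ℕ) : (sierpinskiStage i).Finite := by
  induction i with
  | zero => exact Set.toFinite {(0, 0), (-1, 0), (0, 1), (-1, 1)}
  | succ i ih => exact ih.union ((ih.image _).union (ih.image _))

theorem IsStage.shape_subset {n : ℕ} {b : Bool} {A : Assembly} (h : IsStage n b 0 A) :
    shape A ⊆ sierpinskiStage n := fun c hc =>
  (h.mem_sierpinskiStage c).2 (.inl (by rwa [zero_add]))

theorem IsStage.diff_shape {n : ℕ} {b : Bool} {A : Assembly} (h : IsStage n b 0 A) :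
    sierpinskiStage n \ shape A = {c | Uncovered n b c} := by
  ext c
  have h1 := h.mem_sierpinskiStage c
  have h2 := h.not_uncovered (c := c)
  rw [zero_add] at h1 h2
  rw [Set.mem_sdiff, Set.mem_ofPred_eq, h1]
  exact ⟨fun h => h.1.resolve_left h.2, fun h => ⟨.inr h, fun h' => h2 h' h⟩⟩

theorem encard_uncovered_le (n : ℕ) (b : Bool) : {c | Uncovered n b c}.encard ≤ 6 := by
  have : {c | Uncovered n b c} ⊆ (({(-2 ^ n, 2 * 2 ^ n - 2), (-2 ^ n, 2 * 2 ^ n - 1),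
      (2 ^ n - 1, 2 * 2 ^ n - 2), (2 ^ n - 1, 2 * 2 ^ n - 1), (-1, 0), (0, 0)} :
      Finset (ℤ × ℤ)) : Set (ℤ × ℤ)) := by
    rintro ⟨x, y⟩ h
    simp only [Set.mem_ofPred_eq, Uncovered] at h
    simp only [Finset.coe_insert, Finset.coe_singleton, Set.mem_insert_iff,
      Set.mem_singleton_iff, Prod.mk.injEq]
    generalize (2 : ℤ) ^ n = N at *
    omega
  refine (Set.encard_le_encard this).trans ?_
  rw [Set.encard_coe_eq_coe_finsetCard]
  exact_mod_cast Finset.card_le_six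

theorem IsStage.uncovered_subset_cornerPoints {n : ℕ} {b : Bool} {A : Assembly}
    (h : IsStage n b 0 A) : {c | Uncovered n b c} ⊆ cornerPoints (sierpinskiStage n) := by
  intro c hc
  have hN := h.two_le_pow
  have hb : ∀ d ∈ sierpinskiStage n, -2 ^ n ≤ d.1 ∧ d.1 ≤ 2 ^ n - 1 ∧ 0 ≤ d.2 := by
    intro d hd
    rcases (h.mem_sierpinskiStage d).1 hd with hd | hd
    · obtain ⟨h1, h2, h3, h4, h5, h6, h7⟩ := h.bounds hd
      simp only [zero_add, Prod.fst_zero, Prod.snd_zero] at h1 h2 h3 h4 h5 h6 h7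
      omega
    · simp only [Uncovered] at hd
      omega
  refine ⟨(h.mem_sierpinskiStage c).2 (.inr hc), ?_⟩
  rcases hc with ⟨-, -, hc | hc⟩ | ⟨-, hc, -⟩
  · exact .inl fun d hd => hc ▸ (hb d hd).1
  · exact .inr (.inl fun d hd => hc ▸ (hb d hd).2.1)
  · exact .inr (.inr fun d hd => hc ▸ (hb d hd).2.2)

theorem exists_producible_missing_corners (i : ℕ) : ∃ A, Producible sierpinskiSystem A ∧
    shape A ⊆ sierpinskiStage i ∧
    sierpinskiStage i \ shape A ⊆ cornerPoints (sierpinskiStage i) ∧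
    (sierpinskiStage i \ shape A).encard ≤ 6 := by
  rcases i with _ | i
  -- Every point of the initial square is leftmost or rightmost, so a single tile suffices. The
  -- origin `(0, -1)` puts `c4` at `(0, 0)`.
  · refine ⟨{pt c4 (0, -1)}, Producible.pt _ _, ?_, ?_, ?_⟩
    · rintro c ⟨x, hx, rfl⟩
      rw [Finset.mem_singleton.1 hx, mem_sierpinskiStage_zero]
      decide
    · rintro c ⟨hc, -⟩
      refine ⟨hc, ?_⟩
      rw [mem_sierpinskiStage_zero] at hc
      by_cases h : c.1 = 0
      · refine .inr (.inl fun d hd => ?_)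
        rw [mem_sierpinskiStage_zero] at hd
        omega
      · refine .inl fun d hd => ?_
        rw [mem_sierpinskiStage_zero] at hd
        omega
    · refine (Set.encard_le_encard Set.sdiff_subset).trans ?_
      have : sierpinskiStage 0 =
          (({(0, 0), (-1, 0), (0, 1), (-1, 1)} : Finset (ℤ × ℤ)) : Set (ℤ × ℤ)) := by
        simp [sierpinskiStage]
      rw [this, Set.encard_coe_eq_coe_finsetCard]
      exact_mod_cast (show _ ≤ 6 by decide)
  · obtain ⟨A, hA⟩ := exists_isStage i false 0
    refine ⟨A, hA.producible, hA.shape_subset, ?_, ?_⟩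
    · rw [hA.diff_shape]
      exact hA.uncovered_subset_cornerPoints
    · rw [hA.diff_shape]
      exact encard_uncovered_le _ _

/-- Translated to the origin, a stage or a part of a motif is almost a stage of the fractal. -/
theorem exists_near_stage : ∃ c : ℕ, ∀ A, ((∃ n b p, IsStage n b p A) ∨ ∃ m q, A ⊆ inst m q) →
    ∃ (v : ℤ × ℤ) (i : ℕ), shape (translateBy v A) ⊆ sierpinskiStage i ∧
      (sierpinskiStage i \ shape (translateBy v A)).encard ≤ c := by
  have hstage : ∀ n b p A, IsStage n b p A → IsStage n b 0 (translateBy (-p) A) := by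
    intro n b p A h
    simpa using h.translateBy (-p)
  have hsub : ∀ {v A B}, A ⊆ B → shape (translateBy v A) ⊆ shape (translateBy v B) :=
    fun h => shape_mono (Finset.image_subset_image h)
  -- A stage misses at most `6` points. A part of a motif fits into `sierpinskiStage 2`, whose size
  -- bounds what it misses.
  refine ⟨6 + (sierpinskiStage 2).ncard, fun A hA => ?_⟩
  rcases hA with ⟨n, b, p, hA⟩ | ⟨m, q, hA⟩
  · have h := hstage _ _ _ _ hA
    refine ⟨-p, n, h.shape_subset, ?_⟩
    rw [h.diff_shape]
    refine (encard_uncovered_le _ _).trans ?_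
    exact_mod_cast Nat.le_add_right 6 _
  · have hv : ∃ v, shape (translateBy v A) ⊆ sierpinskiStage 2 := by
      rcases inst_cases m q with ⟨b, h⟩ | ⟨p, B, hB, h⟩
      · exact ⟨-q, (hsub hA).trans ((hstage _ _ _ _ h).shape_subset.trans
          (sierpinskiStage_mono one_le_two))⟩
      · exact ⟨-p, (hsub (hA.trans h.subset)).trans (hstage _ _ _ _ hB).shape_subset⟩
    obtain ⟨v, hv⟩ := hv
    refine ⟨v, 2, hv, (Set.encard_le_encard Set.sdiff_subset).trans ?_⟩
    rw [← (finite_sierpinskiStage 2).cast_ncard_eq]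
    exact_mod_cast Nat.le_add_left _ 6

/-! ### The triangle formed by at most six bodies and links -/

def IsBody (m : Motif) : Prop := m = .core ∨ m = .apex
def IsTopLink (m : Motif) : Prop := m = .top ∨ m = .top'

/-- At most six bodies and links, such that two corners of each body are taken by links and both
ends of each link are taken by bodies, form a triangle of three bodies of the same size: consider
the leftmost and the rightmost of the bodies that reach highest. -/
theorem exists_triangle {α : Type*} [DecidableEq α] (S : Finset α) (hS : S.Nonempty)
    (hcard : S.card ≤ 6) (m : α → Motif) (p : α → ℤ × ℤ) (N : α → ℤ) (hN : ∀ a, 0 < N a)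
    (L R D : α → α → Prop)
    (hL : ∀ a ∈ S, ∀ c ∈ S, L a c → IsBody (m a) ∧
      ((m c = .left ∧ p c = p a + (-N a, 2 * N a - 2)) ∨
        (IsTopLink (m c) ∧ p c = p a + (-N a - 1, 2 * N a - 2))))
    (hR : ∀ a ∈ S, ∀ c ∈ S, R a c → IsBody (m a) ∧
      ((m c = .right ∧ p c = p a + (N a - 1, 2 * N a - 2)) ∨
        (IsTopLink (m c) ∧ p c = p a + (N a - 1, 2 * N a - 2))))
    (hD : ∀ a ∈ S, ∀ c ∈ S, D a c → IsBody (m a) ∧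
      ((m c = .left ∧ p a = p c + (0, 2)) ∨ (m c = .right ∧ p a = p c + (1, 2))))
    (hbody : ∀ a ∈ S, IsBody (m a) → ((∃ c ∈ S, L a c) ∧ ∃ c ∈ S, R a c) ∨
      ((∃ c ∈ S, L a c) ∧ ∃ c ∈ S, D a c) ∨ ((∃ c ∈ S, R a c) ∧ ∃ c ∈ S, D a c))
    (hleft : ∀ c ∈ S, m c = .left → (∃ a ∈ S, L a c) ∧ ∃ a ∈ S, D a c)
    (hright : ∀ c ∈ S, m c = .right → (∃ a ∈ S, R a c) ∧ ∃ a ∈ S, D a c)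
    (htop : ∀ c ∈ S, IsTopLink (m c) → (∃ a ∈ S, L a c) ∧ ∃ a ∈ S, R a c) :
    ∃ x y z l r t, S = {x, y, z, l, r, t} ∧ S.card = 6 ∧ m l = .left ∧ m r = .right ∧ IsTopLink (m t) ∧
      L y l ∧ D x l ∧ R y r ∧ D z r ∧ R x t ∧ L z t ∧ N x = N y ∧ N z = N y ∧
      p x = p y + (-N y, 2 * N y) ∧ p z = p y + (N y, 2 * N y) := by
  classical
  simp only [Prod.ext_iff, Prod.fst_add, Prod.snd_add] at hL hR hD ⊢
  have hmtop : ∀ {c}, IsTopLink c → c ≠ .left ∧ c ≠ .right ∧ ¬ IsBody c := by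
    rintro c (rfl | rfl) <;> simp [IsBody]
  have hne : (S.filter fun a => IsBody (m a)).Nonempty := by
    obtain ⟨a, ha⟩ := hS
    have hex : ∃ b ∈ S, IsBody (m b) := by
      cases h : m a
      · exact ⟨a, ha, .inl h⟩
      · exact ⟨a, ha, .inr h⟩
      · obtain ⟨⟨b, hb, h1⟩, -⟩ := hleft a ha h
        exact ⟨b, hb, (hL b hb a ha h1).1⟩
      · obtain ⟨⟨b, hb, h1⟩, -⟩ := hright a ha h
        exact ⟨b, hb, (hR b hb a ha h1).1⟩
      · obtain ⟨⟨b, hb, h1⟩, -⟩ := htop a ha (.inl h)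
        exact ⟨b, hb, (hL b hb a ha h1).1⟩
      · obtain ⟨⟨b, hb, h1⟩, -⟩ := htop a ha (.inr h)
        exact ⟨b, hb, (hL b hb a ha h1).1⟩
    obtain ⟨b, hb, h⟩ := hex
    exact ⟨b, Finset.mem_filter.2 ⟨hb, h⟩⟩
  obtain ⟨u, hu, hmax⟩ := Finset.exists_max_image _ (fun a => (p a).2 + 2 * N a) hne
  set M := (p u).2 + 2 * N u with hM
  have hle : ∀ a ∈ S, IsBody (m a) → (p a).2 + 2 * N a ≤ M := fun a ha hb =>
    hmax a (Finset.mem_filter.2 ⟨ha, hb⟩)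
  have hne' : (S.filter fun a => IsBody (m a) ∧ (p a).2 + 2 * N a = M).Nonempty :=
    ⟨u, Finset.mem_filter.2 ⟨(Finset.mem_filter.1 hu).1, (Finset.mem_filter.1 hu).2, rfl⟩⟩
  obtain ⟨x, hx, hxmin⟩ := Finset.exists_min_image _ (fun a => (p a).1) hne'
  obtain ⟨z, hz, hzmax⟩ := Finset.exists_max_image _ (fun a => (p a).1) hne'
  obtain ⟨hxS, hxb, hxM⟩ := Finset.mem_filter.1 hx
  obtain ⟨hzS, hzb, hzM⟩ := Finset.mem_filter.1 hz
  have hxmin' : ∀ a ∈ S, IsBody (m a) → (p a).2 + 2 * N a = M → (p x).1 ≤ (p a).1 :=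
    fun a ha h1 h2 => hxmin a (Finset.mem_filter.2 ⟨ha, h1, h2⟩)
  have hzmax' : ∀ a ∈ S, IsBody (m a) → (p a).2 + 2 * N a = M → (p a).1 ≤ (p z).1 :=
    fun a ha h1 h2 => hzmax a (Finset.mem_filter.2 ⟨ha, h1, h2⟩)
  -- A left link at the corner of a highest body would carry another body on its upper end, and that
  -- body would reach above `M`.
  have hLtop : ∀ a ∈ S, (p a).2 + 2 * N a = M → ∀ c ∈ S, L a c →
      IsTopLink (m c) ∧ (p c).1 = (p a).1 + (-N a - 1) ∧ (p c).2 = (p a).2 + (2 * N a - 2) := by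
    intro a ha haM c hc hac
    rcases (hL a ha c hc hac).2 with ⟨h1, h2⟩ | h
    · obtain ⟨-, b, hb, hbc⟩ := hleft c hc h1
      obtain ⟨h3, ⟨-, h4⟩ | ⟨h4, -⟩⟩ := hD b hb c hc hbc
      · have := hle b hb h3
        have := hN a
        have := hN b
        omega
      · rw [h1] at h4
        cases h4
    · exact h
  have hRtop : ∀ a ∈ S, (p a).2 + 2 * N a = M → ∀ c ∈ S, R a c →
      IsTopLink (m c) ∧ (p c).1 = (p a).1 + (N a - 1) ∧ (p c).2 = (p a).2 + (2 * N a - 2) := by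
    intro a ha haM c hc hac
    rcases (hR a ha c hc hac).2 with ⟨h1, h2⟩ | h
    · obtain ⟨-, b, hb, hbc⟩ := hright c hc h1
      obtain ⟨h3, ⟨h4, -⟩ | ⟨-, h4⟩⟩ := hD b hb c hc hbc
      · rw [h1] at h4
        cases h4
      · have := hle b hb h3
        have := hN a
        have := hN b
        omega
    · exact h
  -- A top link there would have at its other end a body that also reaches `M` but lies further
  -- left.
  have hxL : ¬ ∃ c ∈ S, L x c := by
    rintro ⟨c, hc, hxc⟩
    obtain ⟨h1, h2, h3⟩ := hLtop x hxS hxM c hc hxc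
    obtain ⟨-, b, hb, hbc⟩ := htop c hc h1
    obtain ⟨h4, ⟨h5, -⟩ | ⟨-, h5⟩⟩ := hR b hb c hc hbc
    · exact (hmtop h1).2.1 h5
    · have := hxmin' b hb h4 (by omega)
      have := hN x
      have := hN b
      omega
  have hzR : ¬ ∃ c ∈ S, R z c := by
    rintro ⟨c, hc, hzc⟩
    obtain ⟨h1, h2, h3⟩ := hRtop z hzS hzM c hc hzc
    obtain ⟨⟨b, hb, hbc⟩, -⟩ := htop c hc h1
    obtain ⟨h4, ⟨h5, -⟩ | ⟨-, h5⟩⟩ := hL b hb c hc hbc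
    · exact (hmtop h1).1 h5
    · have := hzmax' b hb h4 (by omega)
      have := hN z
      have := hN b
      omega
  obtain ⟨⟨t, ht, hxt⟩, ⟨k, hk, hxk⟩⟩ : (∃ c ∈ S, R x c) ∧ ∃ c ∈ S, D x c := by
    rcases hbody x hxS hxb with ⟨h, -⟩ | ⟨h, -⟩ | h
    exacts [absurd h hxL, absurd h hxL, h]
  obtain ⟨⟨t', ht', hzt'⟩, ⟨k', hk', hzk'⟩⟩ : (∃ c ∈ S, L z c) ∧ ∃ c ∈ S, D z c := by
    rcases hbody z hzS hzb with ⟨-, h⟩ | h | ⟨h, -⟩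
    exacts [absurd h hzR, h, absurd h hzR]
  obtain ⟨htt, htp⟩ := hRtop x hxS hxM t ht hxt
  obtain ⟨z', hz', hzt⟩ := (htop t ht htt).1
  obtain ⟨hzb', ⟨h, -⟩ | ⟨-, hzp⟩⟩ := hL z' hz' t ht hzt
  · exact absurd h (hmtop htt).1
  have hzM' : (p z').2 + 2 * N z' = M := by omega
  have hlt : (p x).1 < (p z).1 := by
    have := hzmax' z' hz' hzb' hzM'
    have := hN x
    have := hN z'
    omega
  have hxz : x ≠ z := by
    rintro rfl
    omega
  -- The link below a highest body hangs at an upper corner of a body `b` whose top is level with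
  -- the base of `a`, hence below `M`.
  have hlower : ∀ a ∈ S, IsBody (m a) → (p a).2 + 2 * N a = M → ∀ c ∈ S, D a c → ∃ b ∈ S,
      IsBody (m b) ∧ (p b).2 + 2 * N b < M ∧
      ((m c = .left ∧ L b c ∧ (p a).1 = (p c).1 ∧ (p a).2 = (p c).2 + 2 ∧
        (p c).1 = (p b).1 - N b ∧ (p c).2 = (p b).2 + (2 * N b - 2)) ∨
      (m c = .right ∧ R b c ∧ (p a).1 = (p c).1 + 1 ∧ (p a).2 = (p c).2 + 2 ∧
        (p c).1 = (p b).1 + N b - 1 ∧ (p c).2 = (p b).2 + (2 * N b - 2))) := by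
    intro a ha hab haM c hc hac
    have := hN a
    obtain ⟨-, ⟨h1, h2⟩ | ⟨h1, h2⟩⟩ := hD a ha c hc hac
    · obtain ⟨⟨b, hb, hbc⟩, -⟩ := hleft c hc h1
      obtain ⟨h3, ⟨-, h4⟩ | ⟨h4, -⟩⟩ := hL b hb c hc hbc
      · exact ⟨b, hb, h3, by omega, .inl ⟨h1, hbc, by omega, by omega, by omega, by omega⟩⟩
      · exact absurd h1 (hmtop h4).1
    · obtain ⟨⟨b, hb, hbc⟩, -⟩ := hright c hc h1
      obtain ⟨h3, ⟨-, h4⟩ | ⟨h4, -⟩⟩ := hR b hb c hc hbc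
      · exact ⟨b, hb, h3, by omega, .inr ⟨h1, hbc, by omega, by omega, by omega, by omega⟩⟩
      · exact absurd h1 (hmtop h4).2.1
  obtain ⟨y, hy, hyb, hyM, hyk⟩ := hlower x hxS hxb hxM k hk hxk
  obtain ⟨y', hy', hyb', hyM', hyk'⟩ := hlower z hzS hzb hzM k' hk' hzk'
  have hkl : m k = .left ∨ m k = .right := hyk.imp And.left And.left
  have hkl' : m k' = .left ∨ m k' = .right := hyk'.imp And.left And.left
  have hlink : ∀ {c}, (c = .left ∨ c = .right) → ¬ IsBody c ∧ ¬ IsTopLink c := by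
    rintro c (rfl | rfl) <;> simp [IsBody, IsTopLink]
  have hkk' : k ≠ k' := by
    rintro rfl
    rcases hyk with ⟨h1, h2⟩ | ⟨h1, h2⟩ <;> rcases hyk' with ⟨h3, h4⟩ | ⟨h3, h4⟩
    · omega
    · rw [h1] at h3
      cases h3
    · rw [h1] at h3
      cases h3
    · omega
  have hbne : ∀ {a c}, IsBody (m a) → ¬ IsBody (m c) → a ≠ c := by
    rintro a c h1 h2 rfl
    exact h2 h1
  have hyx : x ≠ y := by
    rintro rfl
    omega
  have hyz : y ≠ z := by
    rintro rfl
    omega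
  have htk : k ≠ t := by
    rintro rfl
    exact (hlink hkl).2 htt
  have htk' : k' ≠ t := by
    rintro rfl
    exact (hlink hkl').2 htt
  have hnb := (hmtop htt).2.2
  have hcard6 : ({x, y, z, k, k', t} : Finset α).card = 6 := by
    have h1 := hbne hxb (hlink hkl).1
    have h2 := hbne hxb (hlink hkl').1
    have h3 := hbne hyb (hlink hkl).1
    have h4 := hbne hyb (hlink hkl').1
    have h5 := hbne hzb (hlink hkl).1
    have h6 := hbne hzb (hlink hkl').1
    have h7 := hbne hxb hnb
    have h8 := hbne hyb hnb
    have h9 := hbne hzb hnb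
    rw [Finset.card_insert_of_notMem, Finset.card_insert_of_notMem,
      Finset.card_insert_of_notMem, Finset.card_insert_of_notMem, Finset.card_insert_of_notMem,
      Finset.card_singleton] <;> simp [*]
  have hsub : ({x, y, z, k, k', t} : Finset α) ⊆ S := by
    intro a ha
    simp only [Finset.mem_insert, Finset.mem_singleton] at ha
    rcases ha with rfl | rfl | rfl | rfl | rfl | rfl <;> assumption
  -- Six different members are found, so there are no others. In particular both upper bodies stand
  -- on the same lower body `y`.
  have hSeq := (Finset.eq_of_subset_of_card_le hsub (by omega)).symm
  have hbodies : ∀ a ∈ S, IsBody (m a) → a = x ∨ a = y ∨ a = z := by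
    intro a ha hab
    rw [hSeq] at ha
    simp only [Finset.mem_insert, Finset.mem_singleton] at ha
    rcases ha with rfl | rfl | rfl | rfl | rfl | rfl
    · exact .inl rfl
    · exact .inr (.inl rfl)
    · exact .inr (.inr rfl)
    · exact absurd hab (hlink hkl).1
    · exact absurd hab (hlink hkl').1
    · exact absurd hab hnb
  have hNx := hN x
  have hNy := hN y
  have hNz := hN z
  have hyy' : y' = y := by
    rcases hbodies y' hy' hyb' with rfl | rfl | rfl
    · omega
    · rfl
    · omega
  have hzz' : z' = z := by
    rcases hbodies z' hz' hzb' with rfl | rfl | rfl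
    · omega
    · omega
    · rfl
  subst hyy' hzz'
  -- As `x` is left of `z`, it stands on the left link and `z` on the right one. Equal bases and
  -- tops give `N x = N z`, and the horizontal distance `N x + N z = 2 * N y` then gives equal
  -- sizes.
  rcases hyk with ⟨h1, h2, h3⟩ | ⟨h1, h2, h3⟩
  · rcases hyk' with ⟨h4, h5, h6⟩ | ⟨h4, h5, h6⟩
    · omega
    · exact ⟨x, y', z', k, k', t, hSeq, hSeq ▸ hcard6, h1, h4, htt, h2, hxk, h5, hzk', hxt, hzt,
        by omega, by omega, ⟨by omega, by omega⟩, ⟨by omega, by omega⟩⟩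
  · rcases hyk' with ⟨h4, h5, h6⟩ | ⟨h4, h5, h6⟩ <;> omega

/-! ### How labelled pieces can combine -/

/-- The label of a piece: a stage has its index, origin and level, a part of a motif has the name
and the origin of the motif. -/
@[ext] structure Label where
  stage : Option ℕ
  motif : Motif
  origin : ℤ × ℤ
  level : ℕ
deriving DecidableEq

/-- The stable pieces `F i`, each of which is a stage or a part of a motif, form `C`. -/
structure Labelled {r : ℕ} (F : Fin r → Assembly) (C : Assembly) (lab : Fin r → Label) : Prop where
  forms : FormsStable sierpinskiStr 2 F C
  stable : ∀ i, Stable sierpinskiStr 2 (F i)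
  spec : ∀ i, (∃ b, IsStage (lab i).level b (lab i).origin (F i) ∧ (lab i).stage = some i.val ∧
      (lab i).motif = .core) ∨
    (F i ⊆ inst (lab i).motif (lab i).origin ∧ (lab i).stage = none ∧ (lab i).level = 1)

theorem mates_motif : ∀ k k' : Role, Mates k k' →
    (k.motif = .core ∨ k.motif = .apex) ∧ k'.motif ≠ .core ∧ k'.motif ≠ .apex := by
  decide

namespace Labelled

variable {r : ℕ} {F : Fin r → Assembly} {C : Assembly} {lab : Fin r → Label}

theorem mem_iff (h : Labelled F C lab) {x : PlacedTile} : x ∈ C ↔ ∃ i, x ∈ F i := by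
  rw [h.forms.2.1]
  simp

theorem eq_of_mem_shape (h : Labelled F C lab) {i j : Fin r} {c : ℤ × ℤ} (hi : c ∈ shape (F i))
    (hj : c ∈ shape (F j)) : i = j := by
  by_contra hij
  exact Set.disjoint_left.1 (h.forms.1 i j hij) hi hj

theorem exists_pt (h : Labelled F C lab) {i : Fin r} {x : PlacedTile} (hx : x ∈ F i) :
    ∃ k q, pt k q = x := by
  rcases h.spec i with ⟨b, hs, -⟩ | ⟨hs, -⟩
  · exact hs.exists_pt hx
  · obtain ⟨k, -, hk⟩ := mem_inst.1 (hs hx)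
    exact ⟨k, _, hk⟩

/-- For two parts the label can be read off from the motif. If one piece is a stage, it contains the
whole motif, so disjointness makes the two pieces the same. -/
theorem lab_eq_of_motif (h : Labelled F C lab) {i j : Fin r} {k k' : Role} {q : ℤ × ℤ}
    (hk : pt k q ∈ F i) (hk' : pt k' q ∈ F j) (hm : k.motif = k'.motif) : lab i = lab j := by
  rcases h.spec i with ⟨b, hs, -⟩ | ⟨hs, h1, h2⟩
  · rw [h.eq_of_mem_shape (mem_shape_of_mem (hs.motif_mem hk (pt_mem_inst.2 ⟨hm.symm, rfl⟩)))
      (mem_shape_of_mem hk')]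
  rcases h.spec j with ⟨b, hs', -⟩ | ⟨hs', h1', h2'⟩
  · rw [h.eq_of_mem_shape (mem_shape_of_mem (hs'.motif_mem hk' (pt_mem_inst.2 ⟨hm, rfl⟩)))
      (mem_shape_of_mem hk)]
  obtain ⟨h3, h4⟩ := pt_mem_inst.1 (hs hk)
  obtain ⟨h3', h4'⟩ := pt_mem_inst.1 (hs' hk')
  exact Label.ext (h1.trans h1'.symm) (h3.symm.trans (hm.trans h3')) (h4.symm.trans h4')
    (h2.trans h2'.symm)

/-- The tile `k` of `F i`, which belongs to a core or apex, touches the tile `k'` of `F j`, which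
belongs to a link, at matching outer glues. -/
structure Touch (F : Fin r → Assembly) (i j : Fin r) (k k' : Role) (q q' : ℤ × ℤ) : Prop where
  ne : i ≠ j
  left : pt k q ∈ F i
  right : pt k' q' ∈ F j
  mates : Mates k k'
  port : q' + k'.off = q + k.off + k.port
  port' : q + k.off = q' + k'.off + k'.port

/-- Only core and apex tiles are exposed on a stage. A link tile inside a stage faces a tile of that
stage and cannot touch another piece. -/
theorem Touch.right_spec {i j : Fin r} {k k' : Role} {q q' : ℤ × ℤ}
    (ht : Touch F i j k k' q q') (h : Labelled F C lab) :
    F j ⊆ inst k'.motif q' ∧ lab j = ⟨none, k'.motif, q', 1⟩ := by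
  rcases h.spec j with ⟨b, hs, -⟩ | ⟨hs, h1, h2⟩
  · exfalso
    rcases hs.port_cases ht.right with hc | hc
    · rw [← ht.port'] at hc
      exact ht.ne (h.eq_of_mem_shape (mem_shape_of_mem ht.left) hc)
    · have := mates_motif _ _ ht.mates
      rcases hc with ⟨rfl | rfl, -⟩ | ⟨rfl | rfl, -⟩ | ⟨rfl | rfl, -⟩ <;> simp [motif] at this
  · obtain ⟨h3, h4⟩ := pt_mem_inst.1 (hs ht.right)
    rw [h3, h4]
    exact ⟨hs, Label.ext h1 rfl rfl h2⟩

theorem Touch.left_spec {i j : Fin r} {k k' : Role} {q q' : ℤ × ℤ}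
    (ht : Touch F i j k k' q q') (h : Labelled F C lab) : IsBody (lab i).motif ∧
    ∃ b, Exposed (lab i).level b (lab i).origin k q ∧
      (IsStage (lab i).level b (lab i).origin (F i) ∨
        (lab i).level = 1 ∧ F i ⊆ inst (lab i).motif (lab i).origin) := by
  rcases h.spec i with ⟨b, hs, -, hm⟩ | ⟨hs, h1, h2⟩
  · refine ⟨.inl hm, b, ?_, .inl hs⟩
    rcases hs.port_cases ht.left with hc | hc
    · rw [← ht.port] at hc
      exact absurd (h.eq_of_mem_shape hc (mem_shape_of_mem ht.right)) ht.ne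
    · exact hc
  · obtain ⟨h3, rfl⟩ := pt_mem_inst.1 (hs ht.left)
    -- For a part of a core or apex the level `1` makes all corner origins equal to the motif
    -- origin. The value `false` allows the bottom tiles of a core.
    refine ⟨h3 ▸ (mates_motif _ _ ht.mates).1, false, ?_, .inr ⟨h2, hs⟩⟩
    have h4 : leftOrigin 1 (lab i).origin = (lab i).origin := by simp [leftOrigin]
    have h5 : rightOrigin 1 (lab i).origin = (lab i).origin := by simp [rightOrigin]
    rw [Exposed, h2, h4, h5]
    have := ht.mates
    unfold Mates at this
    tauto

/-- Strong bonds occur only inside a motif, hence inside one label. Between labels every bond is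
weak, so a cut between them needs two of them. -/
theorem touch_of_bond (h : Labelled F C lab) {i j : Fin r} {x y : PlacedTile} (hx : x ∈ F i)
    (hy : y ∈ F j) (hne : lab i ≠ lab j) (hb : bond sierpinskiStr x y ≠ 0) :
    bond sierpinskiStr x y ≤ 1 ∧ ∃ k q k' q', x = pt k q ∧ y = pt k' q' ∧
      (Touch F i j k k' q q' ∨ Touch F j i k' k q' q) := by
  obtain ⟨k, q, rfl⟩ := h.exists_pt hx
  obtain ⟨k', q', rfl⟩ := h.exists_pt hy
  have hij : i ≠ j := fun h => hne (h ▸ rfl)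
  rcases bond_pt hb with ⟨hm, rfl⟩ | ⟨hm, hp, hp', h1⟩
  · exact absurd (h.lab_eq_of_motif hx hy hm) hne
  · refine ⟨h1, k, q, k', q', rfl, rfl, hm.imp (fun hm => ?_) fun hm => ?_⟩
    · exact ⟨hij, hx, hy, hm, hp, hp'⟩
    · exact ⟨hij.symm, hy, hx, hm, hp', hp⟩

/-- Unless the pieces with one label form the whole assembly, they have two bonds to others. -/
theorem exists_two_touches (h : Labelled F C lab) (i₀ : Fin r)
    (hC : (Finset.univ.filter fun i => lab i = lab i₀).biUnion F ≠ C) :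
    ∃ x y i j x' y' i' j', lab i = lab i₀ ∧ lab j ≠ lab i₀ ∧ lab i' = lab i₀ ∧ lab j' ≠ lab i₀ ∧
      (x ≠ x' ∨ y ≠ y') ∧
      (∃ k q k' q', x = pt k q ∧ y = pt k' q' ∧
        (Touch F i j k k' q q' ∨ Touch F j i k' k q' q)) ∧
      ∃ k q k' q', x' = pt k q ∧ y' = pt k' q' ∧
        (Touch F i' j' k k' q q' ∨ Touch F j' i' k' k q' q) := by
  have hmem : ∀ x, x ∈ (Finset.univ.filter fun i => lab i = lab i₀).biUnion F ↔
      ∃ i, lab i = lab i₀ ∧ x ∈ F i := by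
    intro x
    simp
  have hsub : (Finset.univ.filter fun i => lab i = lab i₀).biUnion F ⊆ C := by
    intro x hx
    obtain ⟨i, -, hi⟩ := (hmem x).1 hx
    exact h.mem_iff.2 ⟨i, hi⟩
  have hne : ((Finset.univ.filter fun i => lab i = lab i₀).biUnion F).Nonempty := by
    obtain ⟨x, hx⟩ := (h.stable i₀).2.1
    exact ⟨x, (hmem x).2 ⟨i₀, rfl, hx⟩⟩
  have hout : ∀ y ∈ C, y ∉ (Finset.univ.filter fun i => lab i = lab i₀).biUnion F →
      ∃ j, lab j ≠ lab i₀ ∧ y ∈ F j := by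
    intro y hy hy'
    obtain ⟨j, hj⟩ := h.mem_iff.1 hy
    exact ⟨j, fun hl => hy' ((hmem y).2 ⟨j, hl, hj⟩), hj⟩
  rcases h.forms.2.2.exists_bonds hsub hne hC with
    ⟨x, hx, y, hy, hxy, hb⟩ | ⟨x, hx, y, hy, hxy, x', hx', y', hy', hxy', hd, hb, hb'⟩
  · obtain ⟨i, hi, hxi⟩ := (hmem x).1 hx
    obtain ⟨j, hj, hyj⟩ := hout y hy hxy
    have := (h.touch_of_bond hxi hyj (hi.trans_ne hj.symm) (by omega)).1
    omega
  · obtain ⟨i, hi, hxi⟩ := (hmem x).1 hx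
    obtain ⟨j, hj, hyj⟩ := hout y hy hxy
    obtain ⟨i', hi', hxi'⟩ := (hmem x').1 hx'
    obtain ⟨j', hj', hyj'⟩ := hout y' hy' hxy'
    exact ⟨x, y, i, j, x', y', i', j', hi, hj, hi', hj', hd,
      (h.touch_of_bond hxi hyj (hi.trans_ne hj.symm) hb).2,
      (h.touch_of_bond hxi' hyj' (hi'.trans_ne hj'.symm) hb').2⟩

/-- A piece with label `a` touches a link with label `c` at a corner with the tiles `P`. -/
def Meets (F : Fin r → Assembly) (lab : Fin r → Label) (P : Role → Prop) (a c : Label) : Prop :=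
  ∃ i j k k' q q', lab i = a ∧ lab j = c ∧ P k ∧ Touch F i j k k' q q'

def LeftCorner (k : Role) : Prop := k = c0 ∨ k = a0
def RightCorner (k : Role) : Prop := k = c3 ∨ k = a4
def Bottom (k : Role) : Prop := k = c4 ∨ k = c5

theorem corner_cases {k k' : Role} (h : Mates k k') :
    LeftCorner k ∧ (k' = l0 ∨ k' = s3 ∨ k' = t3) ∨
      RightCorner k ∧ (k' = r0 ∨ k' = s0 ∨ k' = t0) ∨
      Bottom k ∧ (k = c5 ∧ k' = l3 ∨ k = c4 ∧ k' = r3) := by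
  unfold Mates at h
  unfold LeftCorner RightCorner Bottom
  tauto

theorem Touch.eq_of_leftCorner {i j : Fin r} {k k' : Role} {q q' : ℤ × ℤ}
    (ht : Touch F i j k k' q q') (h : Labelled F C lab) (hk : LeftCorner k) :
    q = leftOrigin (lab i).level (lab i).origin := by
  obtain ⟨-, b, hx, -⟩ := ht.left_spec h
  rcases hx with ⟨-, hx⟩ | ⟨hx, -⟩ | ⟨hx, -⟩
  · exact hx
  all_goals rcases hk with rfl | rfl <;> simp at hx

theorem Touch.eq_of_rightCorner {i j : Fin r} {k k' : Role} {q q' : ℤ × ℤ}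
    (ht : Touch F i j k k' q q') (h : Labelled F C lab) (hk : RightCorner k) :
    q = rightOrigin (lab i).level (lab i).origin := by
  obtain ⟨-, b, hx, -⟩ := ht.left_spec h
  rcases hx with ⟨hx, -⟩ | ⟨-, hx⟩ | ⟨hx, -⟩
  · rcases hk with rfl | rfl <;> simp at hx
  · exact hx
  · rcases hk with rfl | rfl <;> simp at hx

theorem Touch.eq_of_bottom {i j : Fin r} {k k' : Role} {q q' : ℤ × ℤ}
    (ht : Touch F i j k k' q q') (h : Labelled F C lab) (hk : Bottom k) :
    q = (lab i).origin := by
  obtain ⟨-, b, hx, -⟩ := ht.left_spec h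
  rcases hx with ⟨hx, -⟩ | ⟨hx, -⟩ | ⟨-, -, hx⟩
  · rcases hk with rfl | rfl <;> simp at hx
  · rcases hk with rfl | rfl <;> simp at hx
  · exact hx

theorem meets_left (h : Labelled F C lab) {a c : Label} (hac : Meets F lab LeftCorner a c) :
    IsBody a.motif ∧
      ((c.motif = .left ∧ c.origin = a.origin + (-2 ^ a.level, 2 * 2 ^ a.level - 2)) ∨
        (IsTopLink c.motif ∧
          c.origin = a.origin + (-2 ^ a.level - 1, 2 * 2 ^ a.level - 2))) := by
  obtain ⟨i, j, k, k', q, q', rfl, rfl, hk, ht⟩ := hac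
  refine ⟨(ht.left_spec h).1, ?_⟩
  have hq := ht.eq_of_leftCorner h hk
  have hp := ht.port
  rw [(ht.right_spec h).2]
  rcases corner_cases ht.mates with ⟨-, h'⟩ | ⟨h', -⟩ | ⟨h', -⟩
  · subst hq
    simp only [leftOrigin, Prod.ext_iff, Prod.fst_add, Prod.snd_add] at hp ⊢
    rcases hk with rfl | rfl <;> rcases h' with rfl | rfl | rfl <;>
      simp only [motif, off, port, IsTopLink] at hp ⊢ <;> simp <;> omega
  all_goals rcases hk with rfl | rfl <;> rcases h' with h' | h' <;> simp at h'

theorem meets_right (h : Labelled F C lab) {a c : Label} (hac : Meets F lab RightCorner a c) :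
    IsBody a.motif ∧
      ((c.motif = .right ∧ c.origin = a.origin + (2 ^ a.level - 1, 2 * 2 ^ a.level - 2)) ∨
        (IsTopLink c.motif ∧
          c.origin = a.origin + (2 ^ a.level - 1, 2 * 2 ^ a.level - 2))) := by
  obtain ⟨i, j, k, k', q, q', rfl, rfl, hk, ht⟩ := hac
  refine ⟨(ht.left_spec h).1, ?_⟩
  have hq := ht.eq_of_rightCorner h hk
  have hp := ht.port
  rw [(ht.right_spec h).2]
  rcases corner_cases ht.mates with ⟨h', -⟩ | ⟨-, h'⟩ | ⟨h', -⟩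
  · rcases hk with rfl | rfl <;> rcases h' with h' | h' <;> simp at h'
  · subst hq
    simp only [rightOrigin, Prod.ext_iff, Prod.fst_add, Prod.snd_add] at hp ⊢
    rcases hk with rfl | rfl <;> rcases h' with rfl | rfl | rfl <;>
      simp only [motif, off, port, IsTopLink] at hp ⊢ <;> simp <;> omega
  · rcases hk with rfl | rfl <;> rcases h' with h' | h' <;> simp at h'

theorem meets_bottom (h : Labelled F C lab) {a c : Label} (hac : Meets F lab Bottom a c) :
    IsBody a.motif ∧ ((c.motif = .left ∧ a.origin = c.origin + (0, 2)) ∨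
      (c.motif = .right ∧ a.origin = c.origin + (1, 2))) := by
  obtain ⟨i, j, k, k', q, q', rfl, rfl, hk, ht⟩ := hac
  refine ⟨(ht.left_spec h).1, ?_⟩
  have hq := ht.eq_of_bottom h hk
  have hp := ht.port
  rw [(ht.right_spec h).2, ← hq]
  rcases corner_cases ht.mates with ⟨h', -⟩ | ⟨h', -⟩ | ⟨-, h'⟩
  · rcases hk with rfl | rfl <;> rcases h' with h' | h' <;> simp at h'
  · rcases hk with rfl | rfl <;> rcases h' with h' | h' <;> simp at h'
  · simp only [Prod.ext_iff, Prod.fst_add, Prod.snd_add] at hp ⊢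
    rcases h' with ⟨rfl, rfl⟩ | ⟨rfl, rfl⟩ <;>
      simp only [motif, off, port] at hp ⊢ <;> simp <;> omega

/-- The end of a right link is held by its neighbour in the link. -/
theorem right_end_held (h : Labelled F C lab) {q : ℤ × ℤ} (hr : pt r3 q ∈ C)
    (hC : C ≠ {pt r3 q}) : pt r2 q ∈ C := by
  have hb : ∀ y ∈ C, bond sierpinskiStr (pt r3 q) y ≠ 0 → y = pt r2 q ∨
      (y.1 = q + (1, 3) ∧ bond sierpinskiStr (pt r3 q) y ≤ 1) := by
    intro y hy hb
    obtain ⟨j, hj⟩ := h.mem_iff.1 hy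
    obtain ⟨k, q', rfl⟩ := h.exists_pt hj
    rcases bond_pt hb with ⟨hm, rfl⟩ | ⟨-, hp, -, h1⟩
    · rw [bond_pt_self] at hb
      have key : ∀ k : Role, bond sierpinskiStr (pt r3 0) (pt k 0) ≠ 0 → k = r2 := by decide
      exact .inl (key k hb ▸ rfl)
    · exact .inr ⟨hp.trans (by rw [add_assoc]; rfl), h1⟩
  rcases h.forms.2.2.exists_bonds (Finset.singleton_subset_iff.2 hr)
    (Finset.singleton_nonempty _) hC.symm with
    ⟨x, hx, y, hy, -, hxy⟩ | ⟨x, hx, y, hy, -, x', hx', y', hy', -, hd, hxy, hxy'⟩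
  · rw [Finset.mem_singleton.1 hx] at hxy
    rcases hb y hy (by omega) with rfl | ⟨-, h1⟩
    · exact hy
    · omega
  · rw [Finset.mem_singleton.1 hx] at hxy hd
    rw [Finset.mem_singleton.1 hx'] at hxy' hd
    rcases hb y hy hxy with rfl | ⟨h1, -⟩
    · exact hy
    rcases hb y' hy' hxy' with rfl | ⟨h1', -⟩
    · exact hy'
    exact absurd (h.forms.2.2.1 y hy y' hy' (h1.trans h1'.symm)) (by simpa using hd)

/-- Both tiles of a contact are at determined coordinates, and an assembly has one tile per
coordinate. Hence two different bonds are never at the same corner. -/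
theorem Touch.unique {i j i' j' : Fin r} {k k₁ k' k₁' : Role} {q q₁ q' q₁' : ℤ × ℤ}
    (h : Labelled F C lab) (ht : Touch F i j k k' q q') (ht₁ : Touch F i' j' k₁ k₁' q₁ q₁')
    (ho : k.off = k₁.off) (hp : k.port = k₁.port) (hq : q = q₁) :
    pt k q = pt k₁ q₁ ∧ pt k' q' = pt k₁' q₁' :=
  ⟨h.forms.2.2.1 _ (h.mem_iff.2 ⟨i, ht.left⟩) _ (h.mem_iff.2 ⟨i', ht₁.left⟩)
    (by simp only [pt, ho, hq]),
   h.forms.2.2.1 _ (h.mem_iff.2 ⟨j, ht.right⟩) _ (h.mem_iff.2 ⟨j', ht₁.right⟩)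
    (by simp only [pt, ht.port, ht₁.port, ho, hp, hq])⟩

theorem Touch.unique' {i j i' j' : Fin r} {k k₁ k' k₁' : Role} {q q₁ q' q₁' : ℤ × ℤ}
    (h : Labelled F C lab) (ht : Touch F i j k k' q q') (ht₁ : Touch F i' j' k₁ k₁' q₁ q₁')
    (ho : k' = k₁') (hq : q' = q₁') :
    pt k q = pt k₁ q₁ ∧ pt k' q' = pt k₁' q₁' :=
  ⟨h.forms.2.2.1 _ (h.mem_iff.2 ⟨i, ht.left⟩) _ (h.mem_iff.2 ⟨i', ht₁.left⟩)
    (by simp only [pt, ht.port', ht₁.port', ho, hq]), by rw [ho, hq]⟩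

theorem leftCorner_off_port {k : Role} (h : LeftCorner k) :
    k.off = (-1, 2) ∧ k.port = (-1, 0) := by
  rcases h with rfl | rfl <;> decide

theorem rightCorner_off_port {k : Role} (h : RightCorner k) :
    k.off = (0, 2) ∧ k.port = (1, 0) := by
  rcases h with rfl | rfl <;> decide

/-- The left and the right link cannot both touch the bottom of a piece. -/
theorem not_both_bottom (h : Labelled F C lab) (hC : ∀ m q, ¬ C ⊆ inst m q) {i j i' j' : Fin r}
    {q q' q₁' : ℤ × ℤ} (ht : Touch F i j c4 r3 q q') (ht' : Touch F i' j' c5 l3 q q₁') : False := by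
  have hr := h.mem_iff.2 ⟨j, ht.right⟩
  -- The weak bond to the core cannot hold `r3` alone, so `r2` is present. It would occupy the same
  -- point as `l3`.
  have hr2 := h.right_end_held hr fun hs => hC .right q' (hs ▸ Finset.singleton_subset_iff.2
    (pt_mem_inst.2 ⟨rfl, rfl⟩))
  have hp := ht.port
  have hp' := ht'.port
  have := h.forms.2.2.1 _ hr2 _ (h.mem_iff.2 ⟨j', ht'.right⟩) (by
    simp only [pt, off, port, Prod.ext_iff, Prod.fst_add, Prod.snd_add] at hp hp' ⊢
    omega)
  have := (pt_inj.1 this).1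
  cases this

/-- The label has two different contacts. They are at different corners: each upper corner has room
for one, and a second one at the bottom is excluded by `not_both_bottom`. -/
theorem body_meets (h : Labelled F C lab) (hC : ∀ m q, ¬ C ⊆ inst m q) (i₀ : Fin r)
    (hi₀ : (Finset.univ.filter fun i => lab i = lab i₀).biUnion F ≠ C)
    (hb : IsBody (lab i₀).motif) :
    ((∃ j, Meets F lab LeftCorner (lab i₀) (lab j)) ∧
      ∃ j, Meets F lab RightCorner (lab i₀) (lab j)) ∨
    ((∃ j, Meets F lab LeftCorner (lab i₀) (lab j)) ∧
      ∃ j, Meets F lab Bottom (lab i₀) (lab j)) ∨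
    ((∃ j, Meets F lab RightCorner (lab i₀) (lab j)) ∧
      ∃ j, Meets F lab Bottom (lab i₀) (lab j)) := by
  have hflip : ∀ {i j k k' q q'}, lab i = lab i₀ → ¬ Touch F j i k' k q' q := by
    intro i j k k' q q' hi ht
    rw [← hi, (ht.right_spec h).2] at hb
    have := (mates_motif _ _ ht.mates).2
    exact hb.elim this.1 this.2
  obtain ⟨x, y, i, j, x', y', i', j', hi, -, hi', -, hd, ⟨k, q, k', q', rfl, rfl, ht⟩,
    ⟨k₁, q₁, k₁', q₁', rfl, rfl, ht₁⟩⟩ := h.exists_two_touches i₀ hi₀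
  replace ht := ht.resolve_right (hflip hi)
  replace ht₁ := ht₁.resolve_right (hflip hi')
  have hsame : k.off = k₁.off → k.port = k₁.port → q = q₁ → False := fun h1 h2 h3 => by
    have := Touch.unique h ht ht₁ h1 h2 h3
    tauto
  have hmeet : ∀ {P : Role → Prop}, P k → ∃ j, Meets F lab P (lab i₀) (lab j) :=
    fun hP => ⟨j, i, j, k, k', q, q', hi, rfl, hP, ht⟩
  have hmeet₁ : ∀ {P : Role → Prop}, P k₁ → ∃ j, Meets F lab P (lab i₀) (lab j) :=
    fun hP => ⟨j', i', j', k₁, k₁', q₁, q₁', hi', rfl, hP, ht₁⟩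
  rcases corner_cases ht.mates with ⟨hk, -⟩ | ⟨hk, -⟩ | ⟨hk, hk'⟩ <;>
    rcases corner_cases ht₁.mates with ⟨hk₁, -⟩ | ⟨hk₁, -⟩ | ⟨hk₁, hk₁'⟩
  · exfalso
    obtain ⟨h1, h2⟩ := leftCorner_off_port hk
    obtain ⟨h3, h4⟩ := leftCorner_off_port hk₁
    exact hsame (h1.trans h3.symm) (h2.trans h4.symm)
      (by rw [ht.eq_of_leftCorner h hk, ht₁.eq_of_leftCorner h hk₁, hi, hi'])
  · exact .inl ⟨hmeet hk, hmeet₁ hk₁⟩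
  · exact .inr (.inl ⟨hmeet hk, hmeet₁ hk₁⟩)
  · exact .inl ⟨hmeet₁ hk₁, hmeet hk⟩
  · exfalso
    obtain ⟨h1, h2⟩ := rightCorner_off_port hk
    obtain ⟨h3, h4⟩ := rightCorner_off_port hk₁
    exact hsame (h1.trans h3.symm) (h2.trans h4.symm)
      (by rw [ht.eq_of_rightCorner h hk, ht₁.eq_of_rightCorner h hk₁, hi, hi'])
  · exact .inr (.inr ⟨hmeet hk, hmeet₁ hk₁⟩)
  · exact .inr (.inl ⟨hmeet₁ hk₁, hmeet hk⟩)
  · exact .inr (.inr ⟨hmeet₁ hk₁, hmeet hk⟩)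
  · exfalso
    have hq : q = q₁ := by rw [ht.eq_of_bottom h hk, ht₁.eq_of_bottom h hk₁, hi, hi']
    subst hq
    rcases hk' with ⟨rfl, rfl⟩ | ⟨rfl, rfl⟩ <;> rcases hk₁' with ⟨rfl, rfl⟩ | ⟨rfl, rfl⟩
    · exact hsame rfl rfl rfl
    · exact h.not_both_bottom hC ht₁ ht
    · exact h.not_both_bottom hC ht ht₁
    · exact hsame rfl rfl rfl

/-- Both ends of a link touch other pieces. -/
theorem link_meets (h : Labelled F C lab) (i₀ : Fin r)
    (hi₀ : (Finset.univ.filter fun i => lab i = lab i₀).biUnion F ≠ C)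
    (hb : ¬ IsBody (lab i₀).motif) :
    ((lab i₀).motif = .left → (∃ j, Meets F lab LeftCorner (lab j) (lab i₀)) ∧
      ∃ j, Meets F lab Bottom (lab j) (lab i₀)) ∧
    ((lab i₀).motif = .right → (∃ j, Meets F lab RightCorner (lab j) (lab i₀)) ∧
      ∃ j, Meets F lab Bottom (lab j) (lab i₀)) ∧
    (IsTopLink (lab i₀).motif → (∃ j, Meets F lab LeftCorner (lab j) (lab i₀)) ∧
      ∃ j, Meets F lab RightCorner (lab j) (lab i₀)) := by
  have hflip : ∀ {i j k k' q q'}, lab i = lab i₀ → ¬ Touch F i j k k' q q' := by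
    intro i j k k' q q' hi ht
    exact hb (hi ▸ (ht.left_spec h).1)
  obtain ⟨x, y, i, j, x', y', i', j', hi, -, hi', -, hd, ⟨k', q', k, q, rfl, rfl, ht⟩,
    ⟨k₁', q₁', k₁, q₁, rfl, rfl, ht₁⟩⟩ := h.exists_two_touches i₀ hi₀
  replace ht := ht.resolve_left (hflip hi)
  replace ht₁ := ht₁.resolve_left (hflip hi')
  have hl : lab i₀ = ⟨none, k'.motif, q', 1⟩ := hi ▸ (ht.right_spec h).2
  have hl₁ : lab i₀ = ⟨none, k₁'.motif, q₁', 1⟩ := hi' ▸ (ht₁.right_spec h).2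
  have hm : k'.motif = k₁'.motif := congrArg Label.motif (hl.symm.trans hl₁)
  have hq : q' = q₁' := congrArg Label.origin (hl.symm.trans hl₁)
  have hne : k' ≠ k₁' := fun hk => by
    have := Touch.unique' h ht ht₁ hk hq
    tauto
  have hmeet : ∀ {P : Role → Prop}, P k → ∃ j, Meets F lab P (lab j) (lab i₀) :=
    fun hP => ⟨j, j, i, k, k', q, q', rfl, hi, hP, ht⟩
  have hmeet₁ : ∀ {P : Role → Prop}, P k₁ → ∃ j, Meets F lab P (lab j) (lab i₀) :=
    fun hP => ⟨j', j', i', k₁, k₁', q₁, q₁', rfl, hi', hP, ht₁⟩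
  have hm0 : (lab i₀).motif = k'.motif := by rw [hl]
  rw [hm0]
  rcases corner_cases ht.mates with ⟨hk, h1⟩ | ⟨hk, h1⟩ | ⟨hk, h1⟩ <;>
    rcases corner_cases ht₁.mates with ⟨hk₁, h2⟩ | ⟨hk₁, h2⟩ | ⟨hk₁, h2⟩
  · exfalso
    rcases h1 with rfl | rfl | rfl <;> rcases h2 with rfl | rfl | rfl <;> simp [motif] at hm hne
  · refine ⟨fun hm' => ?_, fun hm' => ?_, fun _ => ⟨hmeet hk, hmeet₁ hk₁⟩⟩
    · rw [hm'] at hm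
      rcases h2 with rfl | rfl | rfl <;> simp [motif] at hm
    · rcases h1 with rfl | rfl | rfl <;> simp [motif] at hm'
  · refine ⟨fun _ => ⟨hmeet hk, hmeet₁ hk₁⟩, fun hm' => ?_, fun hm' => ?_⟩
    · rcases h1 with rfl | rfl | rfl <;> simp [motif] at hm'
    · rw [hm] at hm'
      rcases h2 with ⟨-, rfl⟩ | ⟨-, rfl⟩ <;> simp [motif, IsTopLink] at hm'
  · refine ⟨fun hm' => ?_, fun hm' => ?_, fun _ => ⟨hmeet₁ hk₁, hmeet hk⟩⟩
    · rcases h1 with rfl | rfl | rfl <;> simp [motif] at hm'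
    · rw [hm'] at hm
      rcases h2 with rfl | rfl | rfl <;> simp [motif] at hm
  · exfalso
    rcases h1 with rfl | rfl | rfl <;> rcases h2 with rfl | rfl | rfl <;> simp [motif] at hm hne
  · refine ⟨fun hm' => ?_, fun _ => ⟨hmeet hk, hmeet₁ hk₁⟩, fun hm' => ?_⟩
    · rcases h1 with rfl | rfl | rfl <;> simp [motif] at hm'
    · rw [hm] at hm'
      rcases h2 with ⟨-, rfl⟩ | ⟨-, rfl⟩ <;> simp [motif, IsTopLink] at hm'
  · refine ⟨fun _ => ⟨hmeet₁ hk₁, hmeet hk⟩, fun hm' => ?_, fun hm' => ?_⟩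
    · rw [hm'] at hm
      rcases h2 with rfl | rfl | rfl <;> simp [motif] at hm
    · rcases h1 with ⟨-, rfl⟩ | ⟨-, rfl⟩ <;> simp [motif, IsTopLink] at hm'
  · refine ⟨fun hm' => ?_, fun _ => ⟨hmeet₁ hk₁, hmeet hk⟩, fun hm' => ?_⟩
    · rw [hm'] at hm
      rcases h2 with rfl | rfl | rfl <;> simp [motif] at hm
    · rcases h1 with ⟨-, rfl⟩ | ⟨-, rfl⟩ <;> simp [motif, IsTopLink] at hm'
  · exfalso
    rcases h1 with ⟨-, rfl⟩ | ⟨-, rfl⟩ <;> rcases h2 with ⟨-, rfl⟩ | ⟨-, rfl⟩ <;>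
      simp [motif] at hm hne

/-- A piece that touches links at both upper corners is a complete stage. -/
theorem exists_isStage_of_corners (h : Labelled F C lab) {i j j' : Fin r} {k k' l l' : Role}
    {q q' o o' : ℤ × ℤ} (hl : Touch F i j k k' q q') (hk : LeftCorner k)
    (hr : Touch F i j' l l' o o') (hl' : RightCorner l) :
    ∃ b, IsStage (lab i).level b (lab i).origin (F i) := by
  obtain ⟨hb, b, -, hs | ⟨h1, hs⟩⟩ := hl.left_spec h
  · exact ⟨b, hs⟩
  · have h3 := hl.left
    have h4 := hr.left
    obtain ⟨h5, h6⟩ := pt_mem_inst.1 (hs h3)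
    obtain ⟨h7, h8⟩ := pt_mem_inst.1 (hs h4)
    rw [h1]
    rw [h6] at h3
    rw [h8] at h4
    rcases hb with hb | hb <;> rw [hb] at hs h5 h7 <;> rcases hk with rfl | rfl <;>
      rcases hl' with rfl | rfl <;> simp only [motif, reduceCtorEq] at h5 h7
    · exact ⟨false, (h.stable i).eq_core hs h3 h4 (by decide) ▸ .core _⟩
    · exact ⟨true, (h.stable i).eq_apex hs h3 h4 ▸ .apex _⟩

/-- A piece that touches links at its bottom and elsewhere is a complete stage. -/
theorem isStage_of_bottom (h : Labelled F C lab) {i j j' : Fin r} {k k' l l' : Role}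
    {q q' o o' : ℤ × ℤ} (hb : Touch F i j k k' q q') (hk : Bottom k)
    (hc : Touch F i j' l l' o o') (hl : ¬ Bottom l) :
    IsStage (lab i).level false (lab i).origin (F i) := by
  obtain ⟨hbody, b, hx, hs⟩ := hb.left_spec h
  have hbf : b = false := by
    rcases hx with ⟨hx, -⟩ | ⟨hx, -⟩ | ⟨-, hx, -⟩
    · rcases hk with rfl | rfl <;> simp at hx
    · rcases hk with rfl | rfl <;> simp at hx
    · exact hx
  subst hbf
  rcases hs with hs | ⟨h1, hs⟩
  · exact hs
  · have h3 := hb.left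
    have h4 := hc.left
    obtain ⟨h5, h6⟩ := pt_mem_inst.1 (hs h3)
    obtain ⟨h7, h8⟩ := pt_mem_inst.1 (hs h4)
    have hm : (lab i).motif = .core := by
      rw [← h5]
      rcases hk with rfl | rfl <;> rfl
    rw [h1]
    rw [h6] at h3
    rw [h8] at h4
    rw [hm] at hs
    have hne : k ≠ l := by
      rintro rfl
      exact hl hk
    exact (h.stable i).eq_core hs h3 h4 hne ▸ .core _

/-- If one label is not everything, the labels satisfy the hypotheses of `exists_triangle`. The
resulting triangle has six labels, each with a single complete piece, so it is a stage of the next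
level. -/
theorem isStage_or_subset (h : Labelled F C lab) (hr : r ≤ 6) :
    (∃ n b p, IsStage n b p C) ∨ ∃ m q, C ⊆ inst m q := by
  classical
  by_contra! hcon
  obtain ⟨hstage, hinst⟩ := hcon
  have hblock : ∀ i₀, (Finset.univ.filter fun i => lab i = lab i₀).biUnion F ≠ C := by
    intro i₀ hC
    rcases h.spec i₀ with ⟨b, hs, h1, -⟩ | ⟨-, h1, -⟩
    · refine hstage (lab i₀).level b (lab i₀).origin ?_
      convert hs using 1
      rw [← hC]
      -- The label of a stage stores the index of its piece, so no other piece shares it.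
      have : (Finset.univ.filter fun i => lab i = lab i₀) = {i₀} := by
        ext i
        simp only [Finset.mem_filter, Finset.mem_univ, true_and, Finset.mem_singleton]
        refine ⟨fun hi => ?_, fun hi => hi ▸ rfl⟩
        rcases h.spec i with ⟨-, -, h2, -⟩ | ⟨-, h2, -⟩
        · rw [hi, h1] at h2
          exact (Fin.ext (Option.some.inj h2)).symm
        · rw [hi, h1] at h2
          cases h2
      rw [this, Finset.singleton_biUnion]
    · refine hinst (lab i₀).motif (lab i₀).origin ?_
      rw [← hC]
      refine Finset.biUnion_subset.2 fun i hi => ?_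
      replace hi := (Finset.mem_filter.1 hi).2
      rcases h.spec i with ⟨-, -, h2, -⟩ | ⟨hs, -⟩
      · rw [hi, h1] at h2
        cases h2
      · rwa [hi] at hs
  have hS : ∀ a ∈ Finset.univ.image lab, ∃ i, lab i = a := by
    intro a ha
    simpa using ha
  have hmem : ∀ i, lab i ∈ Finset.univ.image lab := fun i =>
    Finset.mem_image_of_mem _ (Finset.mem_univ i)
  have hup : ∀ {P : Label → Prop}, (∃ j, P (lab j)) → ∃ c ∈ Finset.univ.image lab, P c :=
    fun ⟨j, hj⟩ => ⟨_, hmem j, hj⟩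
  have hne : (Finset.univ.image lab).Nonempty := by
    obtain ⟨x, hx⟩ := h.forms.2.2.2.1
    obtain ⟨i, -⟩ := h.mem_iff.1 hx
    exact ⟨_, hmem i⟩
  have hcard : (Finset.univ.image lab).card ≤ 6 :=
    Finset.card_image_le.trans (by simpa using hr)
  obtain ⟨x, y, z, l, u, t, hseq, hcard6, hml, hmu, hmt, hyl, hxl, hyu, hzu, hxt, hzt, hxy, hzy,
      hpx, hpz⟩ :=
    exists_triangle (Finset.univ.image lab) hne hcard Label.motif Label.origin
    (fun a => 2 ^ a.level) (fun a => by positivity) (Meets F lab LeftCorner)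
    (Meets F lab RightCorner) (Meets F lab Bottom) (fun a _ c _ => h.meets_left)
    (fun a _ c _ => h.meets_right) (fun a _ c _ => h.meets_bottom)
    (by
      intro a ha hb
      obtain ⟨i, rfl⟩ := hS a ha
      exact (h.body_meets hinst i (hblock i) hb).imp (And.imp hup hup)
        (Or.imp (And.imp hup hup) (And.imp hup hup)))
    (by
      intro c hc hm
      obtain ⟨i, rfl⟩ := hS c hc
      have := (h.link_meets i (hblock i) (by simp [IsBody, hm])).1 hm
      exact ⟨hup (P := fun a => Meets F lab _ a _) this.1,
        hup (P := fun a => Meets F lab _ a _) this.2⟩)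
    (by
      intro c hc hm
      obtain ⟨i, rfl⟩ := hS c hc
      have := (h.link_meets i (hblock i) (by simp [IsBody, hm])).2.1 hm
      exact ⟨hup (P := fun a => Meets F lab _ a _) this.1,
        hup (P := fun a => Meets F lab _ a _) this.2⟩)
    (by
      intro c hc hm
      obtain ⟨i, rfl⟩ := hS c hc
      have := (h.link_meets i (hblock i)
        (by rcases hm with hm | hm <;> simp [IsBody, hm])).2.2 hm
      exact ⟨hup (P := fun a => Meets F lab _ a _) this.1,
        hup (P := fun a => Meets F lab _ a _) this.2⟩)
  -- Six labels on at most six pieces: no motif is spread over several pieces.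
  have hinj : Function.Injective lab := by
    have : Set.InjOn lab (Finset.univ : Finset (Fin r)) := by
      refine Finset.card_image_iff.1 (le_antisymm Finset.card_image_le ?_)
      rw [hcard6]
      simpa using hr
    exact fun i j hij => this (by simp) (by simp) hij
  have hex : ∀ a, a ∈ ({x, y, z, l, u, t} : Finset Label) → ∃ i, lab i = a := fun a ha =>
    hS a (hseq ▸ ha)
  obtain ⟨ix, rfl⟩ := hex x (by simp)
  obtain ⟨iy, rfl⟩ := hex y (by simp)
  obtain ⟨iz, rfl⟩ := hex z (by simp)
  obtain ⟨il, rfl⟩ := hex l (by simp)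
  obtain ⟨iu, rfl⟩ := hex u (by simp)
  obtain ⟨it, rfl⟩ := hex t (by simp)
  have huniv : ∀ i, i = ix ∨ i = iy ∨ i = iz ∨ i = il ∨ i = iu ∨ i = it := by
    intro i
    have := hmem i
    rw [hseq] at this
    simpa only [Finset.mem_insert, Finset.mem_singleton, hinj.eq_iff] using this
  have hmeets : ∀ {P : Role → Prop} {i j}, Meets F lab P (lab i) (lab j) →
      ∃ k k' q, P k ∧ Touch F i j k k' q (lab j).origin := by
    rintro P i j ⟨i', j', k, k', q, q', hi, hj, hP, ht⟩
    obtain rfl := hinj hi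
    obtain rfl := hinj hj
    refine ⟨k, k', q, hP, ?_⟩
    rwa [(ht.right_spec h).2]
  have hlt : (lab il).origin = (lab iy).origin +
      (-2 ^ (lab iy).level, 2 * 2 ^ (lab iy).level - 2) := by
    rcases (h.meets_left hyl).2 with ⟨-, h1⟩ | ⟨h1, -⟩
    · exact h1
    · rw [hml] at h1
      simp [IsTopLink] at h1
  have hut : (lab iu).origin = (lab iy).origin +
      (2 ^ (lab iy).level - 1, 2 * 2 ^ (lab iy).level - 2) := by
    rcases (h.meets_right hyu).2 with ⟨-, h1⟩ | ⟨h1, -⟩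
    · exact h1
    · rw [hmu] at h1
      simp [IsTopLink] at h1
  have htt : (lab it).origin = (lab iy).origin + (-1, 4 * 2 ^ (lab iy).level - 2) := by
    rcases (h.meets_right hxt).2 with ⟨h1, -⟩ | ⟨-, h1⟩
    · rw [h1] at hmt
      simp [IsTopLink] at hmt
    · rw [h1, hpx, hxy]
      simp only [Prod.ext_iff, Prod.fst_add, Prod.snd_add]
      constructor <;> ring
  have hlx : (lab ix).level = (lab iy).level := by
    have : (2 : ℕ) ^ (lab ix).level = 2 ^ (lab iy).level := by exact_mod_cast hxy
    exact Nat.pow_right_injective le_rfl this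
  have hlz : (lab iz).level = (lab iy).level := by
    have : (2 : ℕ) ^ (lab iz).level = 2 ^ (lab iy).level := by exact_mod_cast hzy
    exact Nat.pow_right_injective le_rfl this
  obtain ⟨k₁, k₁', q₁, hk₁, ht₁⟩ := hmeets hyl
  obtain ⟨k₂, k₂', q₂, hk₂, ht₂⟩ := hmeets hxl
  obtain ⟨k₃, k₃', q₃, hk₃, ht₃⟩ := hmeets hyu
  obtain ⟨k₄, k₄', q₄, hk₄, ht₄⟩ := hmeets hzu
  obtain ⟨k₅, k₅', q₅, hk₅, ht₅⟩ := hmeets hxt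
  obtain ⟨k₆, k₆', q₆, hk₆, ht₆⟩ := hmeets hzt
  have hnb : ∀ {k}, LeftCorner k ∨ RightCorner k → ¬ Bottom k := by
    rintro k ((rfl | rfl) | (rfl | rfl)) <;> simp [Bottom]
  obtain ⟨b, hY⟩ := h.exists_isStage_of_corners ht₁ hk₁ ht₃ hk₃
  have hX := h.isStage_of_bottom ht₂ hk₂ ht₅ (hnb (.inr hk₅))
  have hZ := h.isStage_of_bottom ht₄ hk₄ ht₆ (hnb (.inl hk₆))
  rw [hlx, hpx] at hX
  rw [hlz, hpz] at hZ
  have hmot : ∀ {i j k k' q q'}, Touch F i j k k' q q' → k'.motif = (lab j).motif :=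
    fun ht => by rw [(ht.right_spec h).2]
  have hcorner : ∀ {k k'}, Mates k k' → (LeftCorner k → k' = l0 ∨ k' = s3 ∨ k' = t3) ∧
      (RightCorner k → k' = r0 ∨ k' = s0 ∨ k' = t0) ∧ (Bottom k → k' = l3 ∨ k' = r3) := by
    intro k k' hm
    rcases corner_cases hm with ⟨rfl | rfl, h'⟩ | ⟨rfl | rfl, h'⟩ | ⟨-, h'⟩
    · simpa [LeftCorner, RightCorner, Bottom] using h'
    · simpa [LeftCorner, RightCorner, Bottom] using h'
    · simpa [LeftCorner, RightCorner, Bottom] using h'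
    · simpa [LeftCorner, RightCorner, Bottom] using h'
    · rcases h' with ⟨rfl, rfl⟩ | ⟨rfl, rfl⟩ <;> simp [LeftCorner, RightCorner, Bottom]
  have hL : F il = inst .left (lab il).origin := by
    have h1 := hmot ht₁
    have h2 := hmot ht₂
    rw [hml] at h1 h2
    have hs := (ht₁.right_spec h).1
    rw [h1] at hs
    have e1 : k₁' = l0 := by
      rcases (hcorner ht₁.mates).1 hk₁ with rfl | rfl | rfl <;> simp [motif] at h1 ⊢
    have e2 : k₂' = l3 := by
      rcases (hcorner ht₂.mates).2.2 hk₂ with rfl | rfl <;> simp [motif] at h2 ⊢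
    exact (h.stable il).eq_left hs (e1 ▸ ht₁.right) (e2 ▸ ht₂.right)
  have hR : F iu = inst .right (lab iu).origin := by
    have h1 := hmot ht₃
    have h2 := hmot ht₄
    rw [hmu] at h1 h2
    have hs := (ht₃.right_spec h).1
    rw [h1] at hs
    have e1 : k₃' = r0 := by
      rcases (hcorner ht₃.mates).2.1 hk₃ with rfl | rfl | rfl <;> simp [motif] at h1 ⊢
    have e2 : k₄' = r3 := by
      rcases (hcorner ht₄.mates).2.2 hk₄ with rfl | rfl <;> simp [motif] at h2 ⊢
    exact (h.stable iu).eq_right hs (e1 ▸ ht₃.right) (e2 ▸ ht₄.right)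
  have hT : F it = inst (lab it).motif (lab it).origin := by
    have h1 := hmot ht₅
    have h2 := hmot ht₆
    have hs := (ht₅.right_spec h).1
    rw [h1] at hs
    rcases hmt with hm | hm <;> rw [hm] at h1 h2 hs ⊢
    · have e1 : k₅' = s0 := by
        rcases (hcorner ht₅.mates).2.1 hk₅ with rfl | rfl | rfl <;> simp [motif] at h1 ⊢
      have e2 : k₆' = s3 := by
        rcases (hcorner ht₆.mates).1 hk₆ with rfl | rfl | rfl <;> simp [motif] at h2 ⊢
      exact (h.stable it).eq_top hs (e1 ▸ ht₅.right) (e2 ▸ ht₆.right)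
    · have e1 : k₅' = t0 := by
        rcases (hcorner ht₅.mates).2.1 hk₅ with rfl | rfl | rfl <;> simp [motif] at h1 ⊢
      have e2 : k₆' = t3 := by
        rcases (hcorner ht₆.mates).1 hk₆ with rfl | rfl | rfl <;> simp [motif] at h2 ⊢
      exact (h.stable it).eq_top' hs (e1 ▸ ht₅.right) (e2 ▸ ht₆.right)
  rw [hlt] at hL
  rw [hut] at hR
  rw [htt] at hT
  refine hstage _ b _ (?_ : IsStage ((lab iy).level + 1) b (lab iy).origin C)
  convert IsStage.step hmt hY hX hZ using 1
  ext w
  rw [mem_biUnion_pieces, h.mem_iff, ← hL, ← hR, ← hT]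
  constructor
  · rintro ⟨i, hi⟩
    rcases huniv i with rfl | rfl | rfl | rfl | rfl | rfl <;> tauto
  · rintro (hi | hi | hi | hi | hi | hi) <;> exact ⟨_, hi⟩

end Labelled

/-! ### Classification of the producible assemblies and conclusion -/

/-- Every producible assembly is a stage or a part of a motif. -/
theorem Producible.isStage_or_subset {A : Assembly} (hA : Producible sierpinskiSystem A) :
    (∃ n b p, IsStage n b p A) ∨ ∃ m q, A ⊆ inst m q := by
  induction hA with
  | base t ht p =>
    obtain ⟨k, -, rfl⟩ := Finset.mem_image.1 ht
    refine .inr ⟨k.motif, p - k.off, Finset.singleton_subset_iff.2 (mem_inst.2 ⟨k, rfl, ?_⟩)⟩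
    simp [_root_.pt]
  | combine r hr F C hF hC ih =>
    obtain ⟨v, hv⟩ := hC
    have hlab : ∀ i, ∃ a : Label, (∃ b, IsStage a.level b a.origin (translateBy (v i) (F i)) ∧
        a.stage = some i.val ∧ a.motif = .core) ∨
        (translateBy (v i) (F i) ⊆ inst a.motif a.origin ∧ a.stage = none ∧ a.level = 1) := by
      intro i
      rcases ih i with ⟨n, b, p, h⟩ | ⟨m, q, h⟩
      · exact ⟨⟨some i.val, .core, p + v i, n⟩, .inl ⟨b, h.translateBy (v i), rfl, rfl⟩⟩
      · refine ⟨⟨none, m, q + v i, 1⟩, .inr ⟨?_, rfl, rfl⟩⟩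
        exact translateBy_inst (v i) m q ▸ Finset.image_subset_image h
    choose lab hlab using hlab
    exact Labelled.isStage_or_subset (lab := lab)
      ⟨hv, fun i => (hF i).stable.translateBy (v i), hlab⟩ hr

theorem theorem1 :
    ∃ Γ : HAMSystem, Γ.hands = 6 ∧ Γ.temperature = 2 ∧ Γ.tiles.card = 30 ∧
      NearPerfectlyAssembles Γ sierpinskiStage ∧
      (∀ i, ∃ A, Producible Γ A ∧ shape A ⊆ sierpinskiStage i ∧
        sierpinskiStage i \ shape A ⊆ cornerPoints (sierpinskiStage i) ∧
        (sierpinskiStage i \ shape A).encard ≤ 6) := by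
  refine ⟨sierpinskiSystem, rfl, rfl, card_tiles, ⟨?_, ⟨6, fun i => ?_⟩, ?_⟩,
    exists_producible_missing_corners⟩
  · intro A hA
    rcases hA.isStage_or_subset with ⟨n, b, p, h⟩ | ⟨m, q, h⟩
    · exact h.growsTo
    · exact growsTo_of_subset_inst hA h
  · obtain ⟨A, h1, h2, -, h3⟩ := exists_producible_missing_corners i
    exact ⟨A, h1, h2, h3⟩
  · obtain ⟨c, hc⟩ := exists_near_stage
    exact ⟨c, fun A hA => hc A hA.isStage_or_subset⟩
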